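/- Let $K\subset\mathbb R^n$ ($n\ge 1$) be a convex body (compact, convex, with nonempty interior). For $x\in\operatorname{int}K$ let $K_x^s = K\cap\{2x-y : y\in K\}$ be the symmetrization of $K$ at $x$, and let $\mathcal E_x=\{E_xu+x : |u|\le 1\}$, with $E_x$ a symmetric positive definite matrix, be John's ellipsoid of $K_x^s$, i.e. the ellipsoid of maximal volume contained in $K_x^s$ (it is centered at $x$ by symmetry). For $r>0$ put $\mathcal E_x(r)=\{rE_xu+x : |u|\le 1\}$, and let $\|v\|_x=(v^TE_x^{-2}v)^{1/2}$. One step of the (non-lazy) John's Walk of radius $r\in(0,1)$ from $x$ draws $z$ uniformly from $\mathcal E_x(r)$; if $x\notin\mathcal E_z(r)$ it stays at $x$; otherwise it moves to $z$ with probability $\min\bigl(1,\operatorname{vol}\mathcal E_x(r)/\operatorname{vol}\mathcal E_z(r)\bigr)$ and stays at $x$ with the remaining probability. Let $P_x$ be the law of the point reached, and let $d_{TV}(P,Q)=\sup_A|P(A)-Q(A)|$, the supremum being over measurable sets $A$. **Theorem.** There is a universal constant $c\in(0,1)$ such that the following holds for every $n\ge1$, with $r=cn^{-5/2}$, every convex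 body $K\subset\mathbb R^n$, every $x\in\operatorname{int}K$ and every $y\in K$. If $t\le 1$ and $$\|y-x\|_x\le \frac{rt}{\sqrt n}=c\,t\,n^{-3},$$ then $$d_{TV}(P_x,P_y)\le \frac34+t .$$ In particular, taking $t=1/8$: if $\|y-x\|_x\le \frac{c}{8}n^{-3}$, then $d_{TV}(P_x,P_y)\le 1-\frac18$. -/

import Mathlib

open MeasureTheory Set
open scoped ENNReal

noncomputable section

namespace JohnWalk

/-- The ellipsoid `{E u + c | |u| ≤ 1}`; it is used for positive definite `E`. -/
def ellipsoid {n : ℕ} (E : Matrix (Fin n) (Fin n) ℝ) (c : EuclideanSpace ℝ (Fin n)) :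
    Set (EuclideanSpace ℝ (Fin n)) :=
  (fun u => Matrix.toEuclideanLin E u + c) '' Metric.closedBall 0 1

/-- The ellipsoid `{E u + c | |u| ≤ 1}`, with `E` positive definite, is contained in `S` and has
maximal volume among all ellipsoids (with arbitrary centre) contained in `S`. -/
def IsJohnEllipsoid {n : ℕ} (S : Set (EuclideanSpace ℝ (Fin n)))
    (E : Matrix (Fin n) (Fin n) ℝ) (c : EuclideanSpace ℝ (Fin n)) : Prop :=
  E.PosDef ∧ ellipsoid E c ⊆ S ∧
    ∀ (F : Matrix (Fin n) (Fin n) ℝ) (d : EuclideanSpace ℝ (Fin n)),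
      F.PosDef → ellipsoid F d ⊆ S → volume (ellipsoid F d) ≤ volume (ellipsoid E c)

/-- The symmetrization `K ∩ {2x - y | y ∈ K}` of `K` at `x`. -/
def symmetrization {n : ℕ} (K : Set (EuclideanSpace ℝ (Fin n)))
    (x : EuclideanSpace ℝ (Fin n)) : Set (EuclideanSpace ℝ (Fin n)) :=
  K ∩ {z | ∃ y ∈ K, z = (2 : ℝ) • x - y}

/-- The positive definite matrix `E_x` for which `{E_x u + x | |u| ≤ 1}` is John's ellipsoid of the
symmetrization of `K` at `x`. The symmetrization is symmetric about `x`, so that for a convex body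
`K` and `x` in its interior this matrix exists and is unique. -/
def johnMatrix {n : ℕ} (K : Set (EuclideanSpace ℝ (Fin n))) (x : EuclideanSpace ℝ (Fin n)) :
    Matrix (Fin n) (Fin n) ℝ :=
  Classical.epsilon fun E => IsJohnEllipsoid (symmetrization K x) E x

/-- The rescaled John's ellipsoid `E_x(r) = {r (E_x u) + x | |u| ≤ 1}`. -/
def johnEllipsoid {n : ℕ} (K : Set (EuclideanSpace ℝ (Fin n))) (r : ℝ)
    (x : EuclideanSpace ℝ (Fin n)) : Set (EuclideanSpace ℝ (Fin n)) :=
  ellipsoid (r • johnMatrix K x) x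

/-- The local norm `‖v‖_x = (vᵀ E_x⁻² v)^{1/2}`. -/
def localNorm {n : ℕ} (K : Set (EuclideanSpace ℝ (Fin n)))
    (x v : EuclideanSpace ℝ (Fin n)) : ℝ :=
  Real.sqrt (dotProduct v.ofLp (Matrix.mulVec ((johnMatrix K x)⁻¹ ^ 2) v.ofLp))

/-- The proposal distribution `Q_x`: the uniform probability measure on `E_x(r)`. -/
def proposal {n : ℕ} (K : Set (EuclideanSpace ℝ (Fin n))) (r : ℝ)
    (x : EuclideanSpace ℝ (Fin n)) : Measure (EuclideanSpace ℝ (Fin n)) :=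
  (volume (johnEllipsoid K r x))⁻¹ • volume.restrict (johnEllipsoid K r x)

/-- The probability of accepting the proposed move from `x` to `z`: it is zero if `x ∉ E_z(r)`, and
`min (1, vol E_x(r) / vol E_z(r))` otherwise. -/
def acceptance {n : ℕ} (K : Set (EuclideanSpace ℝ (Fin n))) (r : ℝ)
    (x : EuclideanSpace ℝ (Fin n)) : EuclideanSpace ℝ (Fin n) → ℝ≥0∞ :=
  {z | x ∈ johnEllipsoid K r z}.indicator
    fun z => min 1 (volume (johnEllipsoid K r x) / volume (johnEllipsoid K r z))

/-- The one-step transition measure `P_x` of the (non-lazy) walk: a point `z` drawn from the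
proposal distribution is accepted with probability `acceptance K r x z`, and the walk stays at `x`
if the proposal is rejected. -/
def transition {n : ℕ} (K : Set (EuclideanSpace ℝ (Fin n))) (r : ℝ)
    (x : EuclideanSpace ℝ (Fin n)) : Measure (EuclideanSpace ℝ (Fin n)) :=
  (proposal K r x).withDensity (acceptance K r x) +
    (1 - ∫⁻ z, acceptance K r x z ∂(proposal K r x)) • Measure.dirac x

/-- The total variation distance `sup_A |P(A) - Q(A)|` of two finite measures, the supremum being
taken over all measurable sets `A`. -/
def tvDist {Ω : Type*} [MeasurableSpace Ω] (P Q : Measure Ω) : ℝ :=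
  ⨆ A : {A : Set Ω // MeasurableSet A}, |P.real A.1 - Q.real A.1|

end JohnWalk

end

/-!
For `x` in the interior of `K`, the ellipsoids centred at `x` in the symmetrization of `K` at `x`
are those in `K`, so `E_x` maximizes `|det F|` among all matrices `F` with `x + F B ⊆ K`, where `B`
is the unit ball. The one fact used about John's ellipsoid is the first-order condition of this
problem, in a form that also covers ellipsoids with another centre: if `z + F B ⊆ K`, then
`tr (E_x⁻¹ F) ≤ n + √n ‖z - x‖_x` (`trace_johnMatrix_inv_mul_le`). In coordinates with `E_x = 1` and
`x = 0`, a contact point `u` of the unit ball gives `⟪u, F u⟫ ≤ 1 + |⟪u, z⟫|`, and the last term is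
dominated by a quadratic form of trace `√n ‖z‖` (`trace_le_of_forall_mem`).

Let `z` satisfy `‖z - x‖_x ≤ r`. Applied at `x` and at `z`, to the ellipsoid of the other point
composed with a suitable rotation, the condition bounds the sum of the singular values `σ` of
`E_x⁻¹ E_z` and the sum of their inverses. Hence `∑ (σ + σ⁻¹ - 2)` is of order `√n r`, that is of
order `c n⁻²`, and every `σ` is within `1 / (20 n)` of `1`
(`exists_orthogonal_norm_le_of_trace_le`, `johnMatrix_stability`). This is where the radius
`c n ^ (-5 / 2)` comes from: ellipsoids that agree up to a factor `1 + O(1 / n)` have comparable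
volumes, and shrinking `E_x(r)` by a factor `1 - O(1 / n)`, at the cost of a bounded factor in
volume, forces its points `z` to satisfy `x ∈ E_z(r)`.

For `‖y - x‖_x ≤ r / (4 √n)` the transition measures from `x` and `y` therefore both dominate
a multiple of Lebesgue measure on a subset of the lens formed by two slightly shrunken ellipsoids
around `x` and `y`. The subset is an affine image of `lensCore`; by Chebyshev's inequality its
volume is a fixed proportion of that of `E_x(r)` (`le_volume_lensCore`). The common part has mass at least `1 / 4`, so
the total variation distance is at most `3 / 4` (`tvDist_transition_le`). The subset is compact, and
only lower bounds for the acceptance probability on it are needed, so that the measurability of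
`E_z` in `z` plays no role.
-/

namespace JohnWalk

variable {n : ℕ}

/-! ### Polar decomposition and singular values -/

lemma toEuclideanLin_mul_apply (A B : Matrix (Fin n) (Fin n) ℝ) (u : EuclideanSpace ℝ (Fin n)) :
    (A * B).toEuclideanLin u = A.toEuclideanLin (B.toEuclideanLin u) := by
  rw [Matrix.toEuclideanLin, Matrix.toLpLin_mul 2 2 2]; rfl

lemma toEuclideanLin_one_apply (u : EuclideanSpace ℝ (Fin n)) :
    (1 : Matrix (Fin n) (Fin n) ℝ).toEuclideanLin u = u := by
  ext i; simp

lemma toEuclideanLin_inv_apply {M : Matrix (Fin n) (Fin n) ℝ} (hM : M.det ≠ 0)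
    (u : EuclideanSpace ℝ (Fin n)) : M⁻¹.toEuclideanLin (M.toEuclideanLin u) = u := by
  rw [← toEuclideanLin_mul_apply, Matrix.nonsing_inv_mul _ (isUnit_iff_ne_zero.2 hM),
    toEuclideanLin_one_apply]

lemma toEuclideanLin_apply_inv {M : Matrix (Fin n) (Fin n) ℝ} (hM : M.det ≠ 0)
    (u : EuclideanSpace ℝ (Fin n)) : M.toEuclideanLin (M⁻¹.toEuclideanLin u) = u := by
  rw [← toEuclideanLin_mul_apply, Matrix.mul_nonsing_inv _ (isUnit_iff_ne_zero.2 hM),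
    toEuclideanLin_one_apply]

lemma det_toEuclideanLin (M : Matrix (Fin n) (Fin n) ℝ) :
    LinearMap.det M.toEuclideanLin = M.det := by
  rw [Matrix.toEuclideanLin_eq_toLin_orthonormal, LinearMap.det_toLin]

lemma inner_toEuclideanLin (A : Matrix (Fin n) (Fin n) ℝ) (u v : EuclideanSpace ℝ (Fin n)) :
    inner ℝ u (A.toEuclideanLin v) = dotProduct u.ofLp (A.mulVec v.ofLp) := by
  rw [← Matrix.inner_toEuclideanCLM]; rfl

lemma norm_toEuclideanLin_sq (A : Matrix (Fin n) (Fin n) ℝ) (u : EuclideanSpace ℝ (Fin n)) :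
    ‖A.toEuclideanLin u‖ ^ 2 = dotProduct u.ofLp ((A.transpose * A).mulVec u.ofLp) := by
  rw [← real_inner_self_eq_norm_sq, inner_toEuclideanLin, ← Matrix.mulVec_mulVec,
    Matrix.dotProduct_mulVec u.ofLp, Matrix.vecMul_transpose]; rfl

lemma norm_toEuclideanLin_orthogonal {Q : Matrix (Fin n) (Fin n) ℝ} (hQ : Q.transpose * Q = 1)
    (u : EuclideanSpace ℝ (Fin n)) : ‖Q.toEuclideanLin u‖ = ‖u‖ := by
  rw [← sq_eq_sq₀ (norm_nonneg _) (norm_nonneg _), norm_toEuclideanLin_sq, hQ, Matrix.one_mulVec,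
    EuclideanSpace.real_norm_sq_eq]
  simp [dotProduct, sq]

lemma norm_toEuclideanLin_diagonal_le {d : Fin n → ℝ} {b : ℝ} (hb : 0 ≤ b) (hd : ∀ i, |d i| ≤ b)
    (u : EuclideanSpace ℝ (Fin n)) : ‖(Matrix.diagonal d).toEuclideanLin u‖ ≤ b * ‖u‖ := by
  rw [← sq_le_sq₀ (norm_nonneg _) (by positivity), mul_pow, EuclideanSpace.real_norm_sq_eq,
    EuclideanSpace.real_norm_sq_eq, Finset.mul_sum]
  refine Finset.sum_le_sum fun i _ => ?_
  have h1 : ((Matrix.diagonal d).toEuclideanLin u).ofLp i = d i * u.ofLp i := by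
    simp [Matrix.mulVec_diagonal]
  rw [h1, mul_pow]
  exact mul_le_mul_of_nonneg_right (sq_le_sq' (abs_le.1 (hd i)).1 (abs_le.1 (hd i)).2)
    (sq_nonneg _)

/-- Polar decomposition of an invertible real matrix, with the positive definite factor
diagonalized. -/
lemma exists_polar {M : Matrix (Fin n) (Fin n) ℝ} (hM : M.det ≠ 0) :
    ∃ (U Q : Matrix (Fin n) (Fin n) ℝ) (l : Fin n → ℝ), U.transpose * U = 1 ∧ Q.transpose * Q = 1 ∧
      (∀ i, 0 < l i) ∧ M = U * Matrix.diagonal l * U.transpose * Q := by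
  have hH : (M * M.transpose).PosDef := by
    have := Matrix.PosDef.mul_conjTranspose_self M (Matrix.vecMul_injective_of_isUnit
      ((Matrix.isUnit_iff_isUnit_det M).2 (isUnit_iff_ne_zero.2 hM)))
    rwa [Matrix.conjTranspose_eq_transpose_of_trivial] at this
  set U : Matrix (Fin n) (Fin n) ℝ := hH.1.eigenvectorUnitary.1 with hU
  set d := hH.1.eigenvalues with hd
  have hUU : U.transpose * U = 1 := by
    have := Matrix.UnitaryGroup.star_mul_self hH.1.eigenvectorUnitary
    rwa [Matrix.star_eq_conjTranspose, Matrix.conjTranspose_eq_transpose_of_trivial] at this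
  have hUU' : U * U.transpose = 1 := mul_eq_one_comm.1 hUU
  have hspec : M * M.transpose = U * Matrix.diagonal d * U.transpose := by
    have := hH.1.spectral_theorem
    rw [Unitary.conjStarAlgAut_apply, Matrix.star_eq_conjTranspose,
      Matrix.conjTranspose_eq_transpose_of_trivial] at this
    simpa using this
  have hdpos : ∀ i, 0 < d i := fun i => hH.eigenvalues_pos i
  set l : Fin n → ℝ := fun i => Real.sqrt (d i) with hl
  have hlpos : ∀ i, 0 < l i := fun i => Real.sqrt_pos.2 (hdpos i)
  have hll : Matrix.diagonal (fun i => (l i)⁻¹) * Matrix.diagonal l = 1 := by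
    rw [Matrix.diagonal_mul_diagonal, ← Matrix.diagonal_one]
    congr 1; ext i; exact inv_mul_cancel₀ (hlpos i).ne'
  have hll' : Matrix.diagonal l * Matrix.diagonal (fun i => (l i)⁻¹) = 1 := mul_eq_one_comm.1 hll
  have hd2 : Matrix.diagonal d = Matrix.diagonal l * Matrix.diagonal l := by
    rw [Matrix.diagonal_mul_diagonal]
    congr 1; ext i; exact (Real.mul_self_sqrt (hdpos i).le).symm
  set N := U * Matrix.diagonal (fun i => (l i)⁻¹) * U.transpose with hN
  have hNt : N.transpose = N := by
    simp [hN, Matrix.transpose_mul, Matrix.mul_assoc]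
  refine ⟨U, N * M, l, hUU, ?_, hlpos, ?_⟩
  · refine mul_eq_one_comm.1 ?_
    rw [Matrix.transpose_mul, hNt]
    calc N * M * (M.transpose * N) = N * (M * M.transpose) * N := by simp only [Matrix.mul_assoc]
      _ = U * (Matrix.diagonal (fun i => (l i)⁻¹) * (U.transpose * U) * Matrix.diagonal l *
            (Matrix.diagonal l * (U.transpose * U) * Matrix.diagonal (fun i => (l i)⁻¹))) *
            U.transpose := by
          rw [hspec, hd2, hN]; simp only [Matrix.mul_assoc]
      _ = 1 := by rw [hUU, Matrix.mul_one, Matrix.mul_one, hll, hll', Matrix.mul_one,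
            Matrix.mul_one, hUU']
  · calc M = U * U.transpose * M := by rw [hUU', Matrix.one_mul]
      _ = U * (Matrix.diagonal l * (U.transpose * U) * Matrix.diagonal (fun i => (l i)⁻¹)) *
          U.transpose * M := by rw [hUU, Matrix.mul_one, hll', Matrix.mul_one]
      _ = _ := by rw [hN]; simp only [Matrix.mul_assoc]

lemma posDef_mul_diagonal_mul_transpose {U : Matrix (Fin n) (Fin n) ℝ} {l : Fin n → ℝ}
    (hU : U.transpose * U = 1) (hl : ∀ i, 0 < l i) :
    (U * Matrix.diagonal l * U.transpose).PosDef := by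
  have h := (Matrix.posDef_diagonal_iff.2 hl).mul_mul_conjTranspose_same (B := U)
    (Matrix.vecMul_injective_of_isUnit (IsUnit.of_mul_eq_one_right _ hU))
  rwa [Matrix.conjTranspose_eq_transpose_of_trivial] at h

lemma ellipsoid_mul_orthogonal {E Q : Matrix (Fin n) (Fin n) ℝ} (hQ : Q.transpose * Q = 1)
    (c : EuclideanSpace ℝ (Fin n)) : ellipsoid (E * Q) c = ellipsoid E c := by
  have hQ' : Q.transpose.transpose * Q.transpose = 1 := by
    rw [Matrix.transpose_transpose]; exact mul_eq_one_comm.1 hQ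
  ext z
  constructor
  · rintro ⟨u, hu, rfl⟩
    refine ⟨Q.toEuclideanLin u, ?_, by simp only [toEuclideanLin_mul_apply]⟩
    simpa [norm_toEuclideanLin_orthogonal hQ] using hu
  · rintro ⟨u, hu, rfl⟩
    refine ⟨Q.transpose.toEuclideanLin u, ?_, ?_⟩
    · simpa [norm_toEuclideanLin_orthogonal hQ'] using hu
    · simp only [← toEuclideanLin_mul_apply, Matrix.mul_assoc]
      rw [mul_eq_one_comm.1 hQ, Matrix.mul_one]

/-- Every nondegenerate ellipsoid is parametrized by a positive definite matrix. -/
lemma exists_posDef_ellipsoid_eq {M : Matrix (Fin n) (Fin n) ℝ} (hM : M.det ≠ 0) :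
    ∃ E : Matrix (Fin n) (Fin n) ℝ, E.PosDef ∧ ∀ c, ellipsoid E c = ellipsoid M c := by
  obtain ⟨U, Q, l, hU, hQ, hl, rfl⟩ := exists_polar hM
  exact ⟨_, posDef_mul_diagonal_mul_transpose hU hl, fun c => (ellipsoid_mul_orthogonal hQ c).symm⟩

lemma le_and_inv_le_of_add_inv_le {x b s : ℝ} (hx : 0 < x) (hb : 1 ≤ b) (h : x + x⁻¹ - 2 ≤ s)
    (hs : s ≤ b + b⁻¹ - 2) : x ≤ b ∧ x⁻¹ ≤ b := by
  have hb0 : 0 < b := by linarith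
  have h1 : x + x⁻¹ ≤ b + b⁻¹ := by linarith
  have h2 : (x - b) * (x * b - 1) ≤ 0 := by
    have e : (x - b) * (x * b - 1) = (x + x⁻¹ - (b + b⁻¹)) * (x * b) := by field_simp; ring
    rw [e]; exact mul_nonpos_of_nonpos_of_nonneg (by linarith) (by positivity)
  constructor
  · by_contra! hc
    nlinarith [mul_pos (sub_pos.2 hc) (show 0 < x * b - 1 by nlinarith)]
  · by_contra! hc
    have h3 : x * b < 1 := by
      have := mul_lt_mul_of_pos_left hc hx
      rwa [mul_inv_cancel₀ hx.ne'] at this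
    nlinarith [mul_pos (show 0 < b - x by nlinarith) (show 0 < 1 - x * b by linarith)]

/-- With `Q` the orthogonal factor of the polar decomposition of `M`, the two traces are the sums
of the singular values of `M` and of their inverses. As `x + x⁻¹ ≥ 2` for `x > 0`, an upper bound
on the sum of the traces controls every single singular value. -/
lemma exists_orthogonal_norm_le_of_trace_le {M : Matrix (Fin n) (Fin n) ℝ} (hM : M.det ≠ 0) :
    ∃ Q : Matrix (Fin n) (Fin n) ℝ, Q.transpose * Q = 1 ∧ ∀ s b : ℝ, 1 ≤ b → s ≤ b + b⁻¹ - 2 →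
      (M * Q.transpose).trace + (M⁻¹ * Q).trace ≤ 2 * n + s →
      ∀ u : EuclideanSpace ℝ (Fin n),
        ‖M.toEuclideanLin u‖ ≤ b * ‖u‖ ∧ ‖M⁻¹.toEuclideanLin u‖ ≤ b * ‖u‖ := by
  obtain ⟨U, Q, l, hU, hQ, hl, hMeq⟩ := exists_polar hM
  have hU' : U * U.transpose = 1 := mul_eq_one_comm.1 hU
  have hQ' : Q * Q.transpose = 1 := mul_eq_one_comm.1 hQ
  have hUt : U.transpose.transpose * U.transpose = 1 := by rwa [Matrix.transpose_transpose]
  have hQt : Q.transpose.transpose * Q.transpose = 1 := by rwa [Matrix.transpose_transpose]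
  have hll : Matrix.diagonal l * Matrix.diagonal (fun i => (l i)⁻¹) = 1 := by
    rw [Matrix.diagonal_mul_diagonal, ← Matrix.diagonal_one]
    congr 1; ext i; exact mul_inv_cancel₀ (hl i).ne'
  have hinv : M⁻¹ = Q.transpose * U * Matrix.diagonal (fun i => (l i)⁻¹) * U.transpose := by
    refine Matrix.inv_eq_right_inv ?_
    calc M * (Q.transpose * U * Matrix.diagonal (fun i => (l i)⁻¹) * U.transpose)
        = U * Matrix.diagonal l * (U.transpose * (Q * Q.transpose) * U) *
          Matrix.diagonal (fun i => (l i)⁻¹) * U.transpose := by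
          rw [hMeq]; simp only [Matrix.mul_assoc]
      _ = U * (Matrix.diagonal l * Matrix.diagonal (fun i => (l i)⁻¹)) * U.transpose := by
          rw [hQ', Matrix.mul_one, hU, Matrix.mul_one]; simp only [Matrix.mul_assoc]
      _ = 1 := by rw [hll, Matrix.mul_one, hU']
  have ht1 : (M * Q.transpose).trace = ∑ i, l i := by
    rw [hMeq, Matrix.mul_assoc, hQ', Matrix.mul_one, Matrix.mul_assoc, Matrix.trace_mul_comm,
      Matrix.mul_assoc, hU, Matrix.mul_one, Matrix.trace_diagonal]
  have ht2 : (M⁻¹ * Q).trace = ∑ i, (l i)⁻¹ := by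
    rw [Matrix.trace_mul_comm, hinv,
      show Q * (Q.transpose * U * Matrix.diagonal (fun i => (l i)⁻¹) * U.transpose)
        = Q * Q.transpose * (U * Matrix.diagonal (fun i => (l i)⁻¹) * U.transpose) by
        simp only [Matrix.mul_assoc], hQ', Matrix.one_mul, Matrix.mul_assoc, Matrix.trace_mul_comm,
      Matrix.mul_assoc, hU, Matrix.mul_one, Matrix.trace_diagonal]
  refine ⟨Q, hQ, fun s b hb hs htr u => ?_⟩
  have hb0 : 0 ≤ b := by linarith
  have hterm : ∀ i, 0 ≤ l i + (l i)⁻¹ - 2 := fun i => by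
    have : l i + (l i)⁻¹ - 2 = (l i - 1) ^ 2 * (l i)⁻¹ := by
      have := (hl i).ne'
      field_simp; ring
    rw [this]; have := hl i; positivity
  have hsum : ∑ i, (l i + (l i)⁻¹ - 2) ≤ s := by
    rw [Finset.sum_sub_distrib, Finset.sum_add_distrib, ← ht1, ← ht2]
    simp; linarith
  have hlb : ∀ i, l i ≤ b ∧ (l i)⁻¹ ≤ b := fun i =>
    le_and_inv_le_of_add_inv_le (hl i) hb
      ((Finset.single_le_sum (fun j _ => hterm j) (Finset.mem_univ i)).trans hsum) hs
  constructor
  · rw [hMeq]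
    simp only [toEuclideanLin_mul_apply]
    rw [norm_toEuclideanLin_orthogonal hU]
    refine (norm_toEuclideanLin_diagonal_le hb0
      (fun i => by rw [abs_of_pos (hl i)]; exact (hlb i).1) _).trans ?_
    rw [norm_toEuclideanLin_orthogonal hUt, norm_toEuclideanLin_orthogonal hQ]
  · rw [hinv]
    simp only [toEuclideanLin_mul_apply]
    rw [norm_toEuclideanLin_orthogonal hQt, norm_toEuclideanLin_orthogonal hU]
    refine (norm_toEuclideanLin_diagonal_le hb0
      (fun i => by rw [abs_of_pos (inv_pos.2 (hl i))]; exact (hlb i).2) _).trans ?_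
    rw [norm_toEuclideanLin_orthogonal hUt]

/-! ### First-order optimality of a maximal ellipsoid -/

/-- At a point `u` where the unit ball touches the boundary of a convex set containing it, the
hyperplane orthogonal to `u` supports the set. -/
lemma inner_le_one_of_notMem_interior {F : Type*} [NormedAddCommGroup F] [InnerProductSpace ℝ F]
    [CompleteSpace F] {L : Set F} (hL : Convex ℝ L) (hB : Metric.closedBall 0 1 ⊆ L) {u : F}
    (hu : ‖u‖ ≤ 1) (hu' : u ∉ interior L) {v : F} (hv : v ∈ L) : inner ℝ u v ≤ 1 := by
  obtain ⟨f, hf⟩ := geometric_hahn_banach_open_point hL.interior isOpen_interior hu'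
  have h0 : (0 : F) ∈ interior L :=
    interior_mono hB (Metric.ball_subset_interior_closedBall (Metric.mem_ball_self one_pos))
  have hfL : ∀ v ∈ L, f v ≤ f u := fun v hv => by
    have h1 : v ∈ closure (interior L) := by
      rw [hL.closure_interior_eq_closure_of_nonempty_interior ⟨0, h0⟩]; exact subset_closure hv
    exact closure_minimal (fun a ha => (hf a ha).le)
      (isClosed_le f.continuous continuous_const : IsClosed {a | f a ≤ f u}) h1
  set a := (InnerProductSpace.toDual ℝ F).symm f with ha
  have hfa : ∀ v, f v = inner ℝ a v := fun v => by simp [ha]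
  have hfu : 0 < f u := by simpa using hf 0 h0
  have ha0 : a ≠ 0 := by rintro h; rw [hfa, h, inner_zero_left] at hfu; exact lt_irrefl _ hfu
  have hna : 0 < ‖a‖ := norm_pos_iff.2 ha0
  have h1 : ‖a‖ ≤ f u := by
    have := hfL (‖a‖⁻¹ • a) (hB (by simp [norm_smul, hna.ne']))
    rw [hfa, inner_smul_right, real_inner_self_eq_norm_sq] at this
    rwa [sq, inv_mul_cancel_left₀ hna.ne'] at this
  have h2 : f u ≤ ‖a‖ * ‖u‖ := by rw [hfa]; exact real_inner_le_norm a u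
  have h3 : f u = ‖a‖ := le_antisymm (h2.trans (mul_le_of_le_one_right hna.le hu)) h1
  have h4 : a = ‖a‖ • u := by
    rw [← sub_eq_zero, ← norm_eq_zero, ← sq_eq_zero_iff]
    refine le_antisymm ?_ (sq_nonneg _)
    rw [norm_sub_sq_real, inner_smul_right, ← hfa, h3, norm_smul, norm_norm, mul_pow]
    have : ‖u‖ ^ 2 ≤ 1 := pow_le_one₀ (norm_nonneg _) hu
    nlinarith [sq_nonneg ‖a‖]
  have h5 : ‖a‖ * inner ℝ u v ≤ ‖a‖ * 1 := by
    rw [mul_one, ← h3, ← real_inner_smul_left, h3, ← h4, ← hfa]; exact (hfL v hv).trans h3.le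
  exact le_of_mul_le_mul_left h5 hna

/-- First-order optimality of the unit ball among the ellipsoids `M B` contained in `L`: a
direction `D` that points inwards at all contact points is feasible, so it cannot increase the
determinant. -/
lemma trace_nonpos_of_inner_le {L : Set (EuclideanSpace ℝ (Fin n))}
    (hB : Metric.closedBall 0 1 ⊆ L)
    (hmax : ∀ M : Matrix (Fin n) (Fin n) ℝ, (∀ u : EuclideanSpace ℝ (Fin n), ‖u‖ ≤ 1 →
      M.toEuclideanLin u ∈ L) → |M.det| ≤ 1)
    (D : Matrix (Fin n) (Fin n) ℝ) {κ : ℝ} (hκ : 0 < κ)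
    (hD : ∀ u : EuclideanSpace ℝ (Fin n), ‖u‖ ≤ 1 → u ∉ interior L →
      inner ℝ u (D.toEuclideanLin u) ≤ -κ) : D.trace ≤ 0 := by
  have hcont : Continuous D.toEuclideanLin := LinearMap.continuous_of_finiteDimensional _
  obtain ⟨N, hN0, hN⟩ : ∃ N : ℝ, 0 < N ∧ ∀ u, ‖u‖ ≤ 1 → ‖D.toEuclideanLin u‖ ≤ N := by
    refine ⟨‖LinearMap.toContinuousLinearMap D.toEuclideanLin‖ + 1, by positivity, fun u hu => ?_⟩
    have := (LinearMap.toContinuousLinearMap D.toEuclideanLin).le_opNorm u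
    refine this.trans ?_
    nlinarith [norm_nonneg (LinearMap.toContinuousLinearMap D.toEuclideanLin), norm_nonneg u]
  -- On the compact set `C`, disjoint from the contact points, there is room for any small step;
  -- elsewhere in the ball a small step along `D` does not increase the norm beyond `1`.
  set C : Set (EuclideanSpace ℝ (Fin n)) :=
    Metric.closedBall 0 1 ∩ {u | -(κ / 2) ≤ inner ℝ u (D.toEuclideanLin u)} with hC
  have hCc : IsCompact C := (isCompact_closedBall _ _).inter_right
    (isClosed_le continuous_const (continuous_id.inner hcont))
  have hCL : C ⊆ interior L := fun u hu => by
    by_contra hc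
    have h1 := hD u (by simpa using hu.1) hc
    have h2 : -(κ / 2) ≤ inner ℝ u (D.toEuclideanLin u) := hu.2
    linarith
  obtain ⟨δ, hδ, hδL⟩ := hCc.exists_cthickening_subset_open isOpen_interior hCL
  have hfeas : ∀ ε : ℝ, 0 < ε → ε < min (δ / N) (κ / N ^ 2) → ∀ u, ‖u‖ ≤ 1 →
      (1 + ε • D).toEuclideanLin u ∈ L := by
    intro ε hε hε' u hu
    have e : (1 + ε • D).toEuclideanLin u = u + ε • D.toEuclideanLin u := by
      rw [map_add, map_smul, LinearMap.add_apply, LinearMap.smul_apply, toEuclideanLin_one_apply]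
    rw [e]
    have hε1 : ε * N ≤ δ := ((lt_div_iff₀ hN0).1 (hε'.trans_le (min_le_left _ _))).le
    have hε2 : ε * N ^ 2 ≤ κ :=
      ((lt_div_iff₀ (by positivity)).1 (hε'.trans_le (min_le_right _ _))).le
    by_cases huC : u ∈ C
    · refine interior_subset (hδL (Metric.mem_cthickening_of_dist_le _ u δ C huC ?_))
      rw [dist_eq_norm, add_sub_cancel_left, norm_smul, Real.norm_of_nonneg hε.le]
      exact (mul_le_mul_of_nonneg_left (hN u hu) hε.le).trans hε1
    · have h1 : inner ℝ u (D.toEuclideanLin u) < -(κ / 2) := by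
        by_contra! hc
        exact huC ⟨by simpa using hu, hc⟩
      refine hB ?_
      rw [mem_closedBall_zero_iff, ← sq_le_one_iff₀ (norm_nonneg _), norm_add_sq_real,
        inner_smul_right, norm_smul, Real.norm_of_nonneg hε.le, mul_pow]
      have h2 : ‖u‖ ^ 2 ≤ 1 := pow_le_one₀ (norm_nonneg _) hu
      have h3 : ‖D.toEuclideanLin u‖ ^ 2 ≤ N ^ 2 := pow_le_pow_left₀ (norm_nonneg _) (hN u hu) 2
      have h4 : ε ^ 2 * ‖D.toEuclideanLin u‖ ^ 2 ≤ ε * κ := by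
        calc ε ^ 2 * ‖D.toEuclideanLin u‖ ^ 2 ≤ ε ^ 2 * N ^ 2 := by gcongr
          _ = ε * (ε * N ^ 2) := by ring
          _ ≤ ε * κ := by gcongr
      nlinarith [mul_lt_mul_of_pos_left h1 hε]
  obtain ⟨p, hp⟩ : ∃ p : Polynomial ℝ, ∀ ε : ℝ,
      (1 + ε • D).det = 1 + D.trace * ε + p.eval ε * ε ^ 2 :=
    ⟨_, fun ε => Matrix.det_one_add_smul ε D⟩
  have hlim : Filter.Tendsto (fun ε : ℝ => D.trace + p.eval ε * ε) (nhdsWithin 0 (Ioi 0))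
      (nhds D.trace) := by
    have : ContinuousAt (fun ε : ℝ => D.trace + p.eval ε * ε) 0 := by fun_prop
    have h := this.tendsto
    simp only [mul_zero, add_zero] at h
    exact h.mono_left nhdsWithin_le_nhds
  have hpos : 0 < min (δ / N) (κ / N ^ 2) := lt_min (by positivity) (by positivity)
  refine le_of_tendsto hlim ?_
  filter_upwards [Ioo_mem_nhdsGT hpos] with ε hε
  have h1 := (abs_le.1 (hmax _ (hfeas ε hε.1 hε.2))).2
  rw [hp] at h1
  have h2 : ε * (D.trace + p.eval ε * ε) ≤ ε * 0 := by nlinarith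
  exact le_of_mul_le_mul_left h2 hε.1

/-- If the unit ball has maximal volume among the ellipsoids `M B` contained in the convex set `L`,
then every ellipsoid `w + F B` in `L` satisfies `tr F ≤ n + √n ‖w‖`. At a contact point `u` the
inclusion gives `⟪u, F u⟫ ≤ 1 - ⟪u, w⟫`, and `|⟪u, w⟫| ≤ δ / 2 + ⟪u, w⟫² / (2δ)` makes the right
side a quadratic form of trace `n + n δ / 2 + ‖w‖² / (2δ)`, to be optimized over `δ`. -/
lemma trace_le_of_forall_mem (hn : 1 ≤ n) {L : Set (EuclideanSpace ℝ (Fin n))} (hL : Convex ℝ L)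
    (hB : Metric.closedBall 0 1 ⊆ L)
    (hmax : ∀ M : Matrix (Fin n) (Fin n) ℝ, (∀ u : EuclideanSpace ℝ (Fin n), ‖u‖ ≤ 1 →
      M.toEuclideanLin u ∈ L) → |M.det| ≤ 1)
    {F : Matrix (Fin n) (Fin n) ℝ} {w : EuclideanSpace ℝ (Fin n)}
    (hF : ∀ u : EuclideanSpace ℝ (Fin n), ‖u‖ ≤ 1 → w + F.toEuclideanLin u ∈ L) :
    F.trace ≤ n + Real.sqrt n * ‖w‖ := by
  have hn0 : (0 : ℝ) < n := by exact_mod_cast hn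
  have hsn : 0 < Real.sqrt n := Real.sqrt_pos.2 hn0
  have hss : Real.sqrt n * Real.sqrt n = n := Real.mul_self_sqrt hn0.le
  have key : ∀ δ κ : ℝ, 0 < δ → 0 < κ →
      F.trace ≤ n * (1 + δ / 2 + κ) + ‖w‖ ^ 2 / (2 * δ) := by
    intro δ κ hδ hκ
    set D : Matrix (Fin n) (Fin n) ℝ := F - (1 + δ / 2 + κ) • 1 -
      (2 * δ)⁻¹ • Matrix.vecMulVec w.ofLp w.ofLp with hD
    have hDin : ∀ u : EuclideanSpace ℝ (Fin n), inner ℝ u (D.toEuclideanLin u) =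
        inner ℝ u (F.toEuclideanLin u) - (1 + δ / 2 + κ) * ‖u‖ ^ 2
          - (2 * δ)⁻¹ * (inner ℝ u w) ^ 2 := by
      intro u
      have h1 : (Matrix.vecMulVec w.ofLp w.ofLp).toEuclideanLin u = (inner ℝ u w : ℝ) • w := by
        ext i
        simp [Matrix.vecMulVec_mulVec, PiLp.inner_apply, dotProduct]
        ring
      rw [hD, map_sub, map_sub, map_smul, map_smul, LinearMap.sub_apply, LinearMap.sub_apply,
        LinearMap.smul_apply, LinearMap.smul_apply, h1, toEuclideanLin_one_apply, inner_sub_right,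
        inner_sub_right, inner_smul_right, inner_smul_right, inner_smul_right,
        real_inner_self_eq_norm_sq]
      ring
    have htr : D.trace = F.trace - n * (1 + δ / 2 + κ) - ‖w‖ ^ 2 / (2 * δ) := by
      rw [hD, Matrix.trace_sub, Matrix.trace_sub, Matrix.trace_smul, Matrix.trace_smul,
        Matrix.trace_one, Matrix.trace_vecMulVec, EuclideanSpace.real_norm_sq_eq]
      simp [dotProduct, ← sq]
      ring
    have := trace_nonpos_of_inner_le hB hmax D hκ ?_
    · linarith
    · intro u hu hu'
      have hu1 : ‖u‖ = 1 := by
        refine le_antisymm hu (not_lt.1 fun hlt => hu' ?_)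
        exact interior_mono hB (Metric.ball_subset_interior_closedBall (by simpa using hlt))
      have h1 := inner_le_one_of_notMem_interior hL hB hu hu' (hF u hu)
      rw [inner_add_right] at h1
      rw [hDin, hu1]
      have h2 : -(inner ℝ u w) ≤ δ / 2 + (2 * δ)⁻¹ * (inner ℝ u w : ℝ) ^ 2 := by
        have : δ / 2 + (2 * δ)⁻¹ * (inner ℝ u w : ℝ) ^ 2 + inner ℝ u w
            = (2 * δ)⁻¹ * (inner ℝ u w + δ) ^ 2 := by field_simp; ring
        have h3 : 0 ≤ (2 * δ)⁻¹ * (inner ℝ u w + δ : ℝ) ^ 2 := by positivity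
        linarith
      linarith
  refine le_of_forall_pos_le_add fun ε hε => ?_
  -- `δ = ‖w‖ / √n` is optimal; adding `κ` to the norm keeps it positive when `w = 0`.
  set κ := ε / (n + Real.sqrt n) with hκ
  have hκ0 : 0 < κ := by positivity
  have hκe : κ * (n + Real.sqrt n) = ε := div_mul_cancel₀ _ (by positivity)
  have hw := norm_nonneg w
  have h := key ((‖w‖ + κ) / Real.sqrt n) κ (by positivity) hκ0
  have h1 : (n : ℝ) * ((‖w‖ + κ) / Real.sqrt n / 2) = Real.sqrt n * (‖w‖ + κ) / 2 := by
    calc (n : ℝ) * ((‖w‖ + κ) / Real.sqrt n / 2)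
        = Real.sqrt n * Real.sqrt n * ((‖w‖ + κ) / Real.sqrt n / 2) := by rw [hss]
      _ = _ := by field_simp
  have h2 : ‖w‖ ^ 2 / (2 * ((‖w‖ + κ) / Real.sqrt n)) ≤ Real.sqrt n * ‖w‖ / 2 := by
    rw [div_le_iff₀ (by positivity)]
    have : Real.sqrt n * ‖w‖ / 2 * (2 * ((‖w‖ + κ) / Real.sqrt n)) = ‖w‖ * (‖w‖ + κ) := by
      field_simp
    rw [this]; nlinarith
  nlinarith [mul_pos hsn hκ0]

/-! ### Existence and stability of John's ellipsoid -/

lemma volume_ellipsoid (F : Matrix (Fin n) (Fin n) ℝ) (c : EuclideanSpace ℝ (Fin n)) :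
    volume (ellipsoid F c) =
      ENNReal.ofReal |F.det| * volume (Metric.closedBall (0 : EuclideanSpace ℝ (Fin n)) 1) := by
  have : ellipsoid F c = (fun z => z + c) '' (F.toEuclideanLin '' Metric.closedBall 0 1) := by
    rw [image_image]; rfl
  rw [this, image_add_right, measure_preimage_add_right, Measure.addHaar_image_linearMap,
    det_toEuclideanLin]

lemma mem_symmetrization {K : Set (EuclideanSpace ℝ (Fin n))} {x z : EuclideanSpace ℝ (Fin n)} :
    z ∈ symmetrization K x ↔ z ∈ K ∧ (2 : ℝ) • x - z ∈ K := by
  refine and_congr_right fun _ => ⟨?_, fun h => ⟨_, h, by simp⟩⟩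
  rintro ⟨y, hy, rfl⟩
  simpa using hy

lemma ellipsoid_subset_symmetrization {K : Set (EuclideanSpace ℝ (Fin n))}
    {x : EuclideanSpace ℝ (Fin n)} {F : Matrix (Fin n) (Fin n) ℝ}
    (hF : ∀ u : EuclideanSpace ℝ (Fin n), ‖u‖ ≤ 1 → x + F.toEuclideanLin u ∈ K) :
    ellipsoid F x ⊆ symmetrization K x := by
  rintro _ ⟨u, hu, rfl⟩
  have hu' : ‖u‖ ≤ 1 := by simpa using hu
  refine mem_symmetrization.2 ⟨?_, ?_⟩
  · simpa [add_comm] using hF u hu'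
  · have := hF (-u) (by simpa using hu')
    convert this using 1
    simp only [map_neg, two_smul]; abel

/-- By symmetry and convexity, an ellipsoid in the symmetrization can be recentred. -/
lemma add_mem_of_ellipsoid_subset {K : Set (EuclideanSpace ℝ (Fin n))} (hK : Convex ℝ K)
    {x d : EuclideanSpace ℝ (Fin n)} {F : Matrix (Fin n) (Fin n) ℝ}
    (hF : ellipsoid F d ⊆ symmetrization K x) {u : EuclideanSpace ℝ (Fin n)} (hu : ‖u‖ ≤ 1) :
    x + F.toEuclideanLin u ∈ K := by
  have h1 := (mem_symmetrization.1 (hF ⟨u, by simpa using hu, rfl⟩)).1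
  have h2 := (mem_symmetrization.1 (hF ⟨-u, by simpa using hu, rfl⟩)).2
  have := hK h1 h2 (show (0 : ℝ) ≤ 1 / 2 by norm_num) (show (0 : ℝ) ≤ 1 / 2 by norm_num)
    (by norm_num)
  convert this using 1
  simp only [map_neg]
  module

/-- Among the matrices `F` with `x + F B ⊆ K` there is one of maximal determinant. -/
lemma exists_max_det {K : Set (EuclideanSpace ℝ (Fin n))} (hKc : IsCompact K)
    {x : EuclideanSpace ℝ (Fin n)} (hx : x ∈ interior K) :
    ∃ F : Matrix (Fin n) (Fin n) ℝ,
      (∀ u : EuclideanSpace ℝ (Fin n), ‖u‖ ≤ 1 → x + F.toEuclideanLin u ∈ K) ∧ F.det ≠ 0 ∧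
      ∀ G : Matrix (Fin n) (Fin n) ℝ,
        (∀ u : EuclideanSpace ℝ (Fin n), ‖u‖ ≤ 1 → x + G.toEuclideanLin u ∈ K) →
        |G.det| ≤ |F.det| := by
  set S : Set (Matrix (Fin n) (Fin n) ℝ) :=
    {F | ∀ u : EuclideanSpace ℝ (Fin n), ‖u‖ ≤ 1 → x + F.toEuclideanLin u ∈ K} with hS
  have hclosed : IsClosed S := by
    have : S = ⋂ (u : EuclideanSpace ℝ (Fin n)) (_ : ‖u‖ ≤ 1),
        (fun F : Matrix (Fin n) (Fin n) ℝ => x + F.toEuclideanLin u) ⁻¹' K := by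
      ext F; simp [hS]
    rw [this]
    refine isClosed_iInter fun u => isClosed_iInter fun _ => hKc.isClosed.preimage ?_
    refine continuous_const.add ((PiLp.continuous_toLp 2 _).comp ?_)
    exact Continuous.matrix_mulVec continuous_id continuous_const
  obtain ⟨R, hR⟩ := hKc.isBounded.exists_norm_le
  have hbdd : S ⊆ Set.pi univ fun _ : Fin n => Set.pi univ fun _ : Fin n =>
      Icc (-(2 * R)) (2 * R) := by
    intro F hF i _ j _
    have h1 := hR _ (hF (EuclideanSpace.single j 1) (by simp))
    have h2 := hR _ (interior_subset hx)
    have h3 : ‖F.toEuclideanLin (EuclideanSpace.single j 1)‖ ≤ 2 * R := by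
      calc ‖F.toEuclideanLin (EuclideanSpace.single j 1)‖
          = ‖(x + F.toEuclideanLin (EuclideanSpace.single j 1)) - x‖ := by
            rw [add_sub_cancel_left]
        _ ≤ 2 * R := (norm_sub_le _ _).trans (by linarith)
    have h4 := (PiLp.norm_apply_le (F.toEuclideanLin (EuclideanSpace.single j 1)) i).trans h3
    have h5 : (F.toEuclideanLin (EuclideanSpace.single j 1)).ofLp i = F i j := by
      simp
    rw [h5, Real.norm_eq_abs] at h4
    exact abs_le.1 h4
  have hcomp : IsCompact S := IsCompact.of_isClosed_subset
    (isCompact_univ_pi fun _ => isCompact_univ_pi fun _ => isCompact_Icc) hclosed hbdd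
  obtain ⟨ε, hε, hεK⟩ := Metric.mem_nhds_iff.1 (mem_interior_iff_mem_nhds.1 hx)
  have hball : ((ε / 2) • (1 : Matrix (Fin n) (Fin n) ℝ)) ∈ S := by
    intro u hu
    refine hεK ?_
    rw [map_smul, LinearMap.smul_apply, toEuclideanLin_one_apply, Metric.mem_ball, dist_eq_norm,
      add_sub_cancel_left, norm_smul, Real.norm_of_nonneg (by positivity)]
    nlinarith
  have hdetc : Continuous fun F : Matrix (Fin n) (Fin n) ℝ => |F.det| :=
    (Continuous.matrix_det continuous_id).abs
  obtain ⟨F, hF, hmax⟩ := hcomp.exists_isMaxOn ⟨_, hball⟩ hdetc.continuousOn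
  refine ⟨F, hF, ?_, fun G hG => hmax hG⟩
  have h1 : |((ε / 2) • (1 : Matrix (Fin n) (Fin n) ℝ)).det| ≤ |F.det| := hmax hball
  rw [Matrix.det_smul, Matrix.det_one, mul_one] at h1
  have h2 : 0 < |(ε / 2) ^ Fintype.card (Fin n)| := by positivity
  exact abs_pos.1 (h2.trans_le h1)

lemma isJohnEllipsoid_johnMatrix {K : Set (EuclideanSpace ℝ (Fin n))} (hK : Convex ℝ K)
    (hKc : IsCompact K) {x : EuclideanSpace ℝ (Fin n)} (hx : x ∈ interior K) :
    IsJohnEllipsoid (symmetrization K x) (johnMatrix K x) x := by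
  refine Classical.epsilon_spec (p := fun E => IsJohnEllipsoid (symmetrization K x) E x) ?_
  obtain ⟨F, hF, hF0, hmax⟩ := exists_max_det hKc hx
  obtain ⟨E, hE, hEF⟩ := exists_posDef_ellipsoid_eq hF0
  refine ⟨E, hE, ?_, fun G d _ hG => ?_⟩
  · rw [hEF]; exact ellipsoid_subset_symmetrization hF
  · rw [hEF, volume_ellipsoid, volume_ellipsoid]
    refine mul_le_mul_left (ENNReal.ofReal_le_ofReal ?_) _
    exact hmax G fun u hu => add_mem_of_ellipsoid_subset hK hG hu

lemma posDef_johnMatrix {K : Set (EuclideanSpace ℝ (Fin n))} (hK : Convex ℝ K)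
    (hKc : IsCompact K) {x : EuclideanSpace ℝ (Fin n)} (hx : x ∈ interior K) :
    (johnMatrix K x).PosDef := (isJohnEllipsoid_johnMatrix hK hKc hx).1

lemma add_johnMatrix_mem {K : Set (EuclideanSpace ℝ (Fin n))} (hK : Convex ℝ K)
    (hKc : IsCompact K) {x : EuclideanSpace ℝ (Fin n)} (hx : x ∈ interior K)
    {u : EuclideanSpace ℝ (Fin n)} (hu : ‖u‖ ≤ 1) :
    x + (johnMatrix K x).toEuclideanLin u ∈ K :=
  add_mem_of_ellipsoid_subset hK (isJohnEllipsoid_johnMatrix hK hKc hx).2.1 hu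

/-- John's ellipsoid maximizes the volume among all parametrized ellipsoids `x + F B` in `K`,
including those given by matrices that are not positive definite. -/
lemma abs_det_le_det_johnMatrix {K : Set (EuclideanSpace ℝ (Fin n))} (hK : Convex ℝ K)
    (hKc : IsCompact K) {x : EuclideanSpace ℝ (Fin n)} (hx : x ∈ interior K)
    {F : Matrix (Fin n) (Fin n) ℝ}
    (hF : ∀ u : EuclideanSpace ℝ (Fin n), ‖u‖ ≤ 1 → x + F.toEuclideanLin u ∈ K) :
    |F.det| ≤ (johnMatrix K x).det := by
  have hE := isJohnEllipsoid_johnMatrix hK hKc hx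
  by_cases hF0 : F.det = 0
  · rw [hF0, abs_zero]; exact hE.1.det_pos.le
  obtain ⟨G, hG, hGF⟩ := exists_posDef_ellipsoid_eq hF0
  have h := hE.2.2 G x hG (by rw [hGF]; exact ellipsoid_subset_symmetrization hF)
  rw [hGF, volume_ellipsoid, volume_ellipsoid, abs_of_pos hE.1.det_pos] at h
  have hB0 : volume (Metric.closedBall (0 : EuclideanSpace ℝ (Fin n)) 1) ≠ 0 :=
    (Metric.measure_closedBall_pos _ _ one_pos).ne'
  have hBt : volume (Metric.closedBall (0 : EuclideanSpace ℝ (Fin n)) 1) ≠ ⊤ :=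
    measure_closedBall_lt_top.ne
  rwa [ENNReal.mul_le_mul_iff_left hB0 hBt, ENNReal.ofReal_le_ofReal_iff hE.1.det_pos.le] at h

/-- The trace bound `trace_le_of_forall_mem` in the coordinates of John's ellipsoid at `x`. -/
lemma trace_johnMatrix_inv_mul_le (hn : 1 ≤ n) {K : Set (EuclideanSpace ℝ (Fin n))}
    (hK : Convex ℝ K) (hKc : IsCompact K) {x : EuclideanSpace ℝ (Fin n)} (hx : x ∈ interior K)
    {z : EuclideanSpace ℝ (Fin n)} {F : Matrix (Fin n) (Fin n) ℝ}
    (hF : ∀ u : EuclideanSpace ℝ (Fin n), ‖u‖ ≤ 1 → z + F.toEuclideanLin u ∈ K) :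
    ((johnMatrix K x)⁻¹ * F).trace ≤
      n + Real.sqrt n * ‖(johnMatrix K x)⁻¹.toEuclideanLin (z - x)‖ := by
  have hdet := (posDef_johnMatrix hK hKc hx).det_pos
  set E := johnMatrix K x with hE
  refine trace_le_of_forall_mem (L := {v | x + E.toEuclideanLin v ∈ K}) hn ?_ ?_ ?_ ?_
  · intro u hu v hv a b ha hb hab
    have := hK hu hv ha hb hab
    change x + E.toEuclideanLin (a • u + b • v) ∈ K
    convert this using 1
    rw [map_add, map_smul, map_smul]
    nth_rewrite 1 [← one_smul ℝ x]
    rw [← hab]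
    module
  · intro u hu
    exact add_johnMatrix_mem hK hKc hx (by simpa using hu)
  · intro M hM
    have h := abs_det_le_det_johnMatrix hK hKc hx (F := E * M)
      (fun u hu => by rw [toEuclideanLin_mul_apply]; exact hM u hu)
    rw [Matrix.det_mul, abs_mul, ← hE, abs_of_pos hdet] at h
    exact le_of_mul_le_mul_left (by rwa [mul_one]) hdet
  · intro u hu
    change x + E.toEuclideanLin _ ∈ K
    rw [map_add, toEuclideanLin_mul_apply, toEuclideanLin_apply_inv hdet.ne',
      toEuclideanLin_apply_inv hdet.ne', ← add_assoc, add_sub_cancel]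
    exact hF u hu

/-- A chord of `K` bisected by `z` lies in the `n`-fold dilation of John's ellipsoid at `z`. -/
lemma norm_johnMatrix_inv_le (hn : 1 ≤ n) {K : Set (EuclideanSpace ℝ (Fin n))}
    (hK : Convex ℝ K) (hKc : IsCompact K) {z : EuclideanSpace ℝ (Fin n)} (hz : z ∈ interior K)
    {p : EuclideanSpace ℝ (Fin n)} (h1 : z + p ∈ K) (h2 : z - p ∈ K) :
    ‖(johnMatrix K z)⁻¹.toEuclideanLin p‖ ≤ n := by
  set E := johnMatrix K z with hE
  set a := E⁻¹.toEuclideanLin p with ha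
  by_cases ha0 : a = 0
  · rw [ha0, norm_zero]; positivity
  have hna : 0 < ‖a‖ := norm_pos_iff.2 ha0
  -- The trace bound is applied to the segment `[z - p, z + p]`, a degenerate ellipsoid.
  set q := ‖a‖⁻¹ • a with hq
  have hqn : ‖q‖ = 1 := by rw [hq, norm_smul, norm_inv, norm_norm, inv_mul_cancel₀ hna.ne']
  have h := trace_johnMatrix_inv_mul_le hn hK hKc hz (z := z)
    (F := Matrix.vecMulVec p.ofLp q.ofLp) ?_
  · rw [sub_self, map_zero, norm_zero, mul_zero, add_zero, Matrix.mul_vecMulVec,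
      Matrix.trace_vecMulVec] at h
    have e : (johnMatrix K z)⁻¹.mulVec p.ofLp ⬝ᵥ q.ofLp = ‖a‖ := by
      have : (inner ℝ q a : ℝ) = ‖a‖ := by
        rw [hq, real_inner_smul_left, real_inner_self_eq_norm_sq, sq, inv_mul_cancel_left₀ hna.ne']
      rw [← this, ha, inner_toEuclideanLin, dotProduct_comm]
    rwa [e] at h
  · intro u hu
    have e : (Matrix.vecMulVec p.ofLp q.ofLp).toEuclideanLin u = (inner ℝ q u : ℝ) • p := by
      ext i
      simp [Matrix.vecMulVec_mulVec, PiLp.inner_apply, dotProduct, mul_comm]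
    rw [e]
    have hs : |(inner ℝ q u : ℝ)| ≤ 1 :=
      (abs_real_inner_le_norm q u).trans (by rw [hqn, one_mul]; exact hu)
    set s : ℝ := inner ℝ q u with hsdef
    have hs' := abs_le.1 hs
    have := hK h1 h2 (show (0 : ℝ) ≤ (1 + s) / 2 by linarith)
      (show (0 : ℝ) ≤ (1 - s) / 2 by linarith) (by ring)
    convert this using 1
    module

/-- A point at local distance less than one from `x` is an interior point of `K`. -/
lemma mem_interior_of_norm_lt {K : Set (EuclideanSpace ℝ (Fin n))} (hK : Convex ℝ K)
    (hKc : IsCompact K) {x : EuclideanSpace ℝ (Fin n)} (hx : x ∈ interior K)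
    {z : EuclideanSpace ℝ (Fin n)} (hz : ‖(johnMatrix K x)⁻¹.toEuclideanLin (z - x)‖ < 1) :
    z ∈ interior K := by
  have hdet := (posDef_johnMatrix hK hKc hx).det_pos
  refine mem_interior.2 ⟨{y | ‖(johnMatrix K x)⁻¹.toEuclideanLin (y - x)‖ < 1}, ?_, ?_, hz⟩
  · intro y hy
    have := add_johnMatrix_mem hK hKc hx (le_of_lt hy)
    rwa [toEuclideanLin_apply_inv hdet.ne', add_sub_cancel] at this
  · have : Continuous (johnMatrix K x)⁻¹.toEuclideanLin :=
      LinearMap.continuous_of_finiteDimensional _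
    exact isOpen_lt (by fun_prop) continuous_const

/-- Stability of John's ellipsoid: if `z` is at local distance at most `n ^ (-5 / 2) / 10000` from
`x`, the ellipsoids at `x` and `z` agree up to a factor `1 + 1 / (20 n)`. The trace bound at both
points controls the singular values of `E_x⁻¹ E_z`. It involves the distance as measured at
`z`, for which a first application of the argument, with the crude bound of
`norm_johnMatrix_inv_le`, gives the factor `2`. -/
lemma johnMatrix_stability (hn : 1 ≤ n) {K : Set (EuclideanSpace ℝ (Fin n))}
    (hK : Convex ℝ K) (hKc : IsCompact K) {x : EuclideanSpace ℝ (Fin n)} (hx : x ∈ interior K)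
    {z : EuclideanSpace ℝ (Fin n)}
    (hz : (n : ℝ) ^ 2 * Real.sqrt n * ‖(johnMatrix K x)⁻¹.toEuclideanLin (z - x)‖ ≤ 1 / 10000) :
    z ∈ interior K ∧ ∀ u : EuclideanSpace ℝ (Fin n),
      ‖((johnMatrix K x)⁻¹ * johnMatrix K z).toEuclideanLin u‖ ≤ (1 + 1 / (20 * n)) * ‖u‖ ∧
      ‖((johnMatrix K z)⁻¹ * johnMatrix K x).toEuclideanLin u‖ ≤ (1 + 1 / (20 * n)) * ‖u‖ := by
  have hn1 : (1 : ℝ) ≤ n := by exact_mod_cast hn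
  have hs1 : 1 ≤ Real.sqrt n := Real.one_le_sqrt.2 hn1
  set ρ := ‖(johnMatrix K x)⁻¹.toEuclideanLin (z - x)‖ with hρ
  have hρ0 : 0 ≤ ρ := norm_nonneg _
  have hn2 : (1 : ℝ) ≤ n ^ 2 := one_le_pow₀ hn1
  have hsρ : 0 ≤ Real.sqrt n * ρ := by positivity
  have hρs : ρ ≤ Real.sqrt n * ρ := le_mul_of_one_le_left hρ0 hs1
  have hz' : (n : ℝ) ^ 2 * (Real.sqrt n * ρ) ≤ 1 / 10000 := by rwa [← mul_assoc]
  have hnsρ : (n : ℝ) * (Real.sqrt n * ρ) ≤ 1 / 10000 := by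
    refine le_trans ?_ hz'
    gcongr
    nlinarith
  have hsρ1 : Real.sqrt n * ρ ≤ 1 / 10000 := by nlinarith
  have hzK : z ∈ interior K := mem_interior_of_norm_lt hK hKc hx (by linarith)
  refine ⟨hzK, ?_⟩
  have hdx := (posDef_johnMatrix hK hKc hx).det_pos
  have hdz := (posDef_johnMatrix hK hKc hzK).det_pos
  have hxmem : ∀ y, ‖(johnMatrix K x)⁻¹.toEuclideanLin (y - x)‖ ≤ 1 → y ∈ K := fun y hy => by
    have := add_johnMatrix_mem hK hKc hx hy
    rwa [toEuclideanLin_apply_inv hdx.ne', add_sub_cancel] at this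
  set Ex := johnMatrix K x with hEx
  set Ez := johnMatrix K z with hEz
  set ρ' := ‖Ez⁻¹.toEuclideanLin (x - z)‖ with hρ'
  -- The points `z ± (x - z) / (2ρ)` are at local distance at most `ρ + 1 / 2` from `x`.
  have hcrude : ρ' ≤ 2 * n * ρ := by
    rcases hρ0.eq_or_lt with h0 | h0
    · have h1 : z - x = 0 := by
        rw [← toEuclideanLin_apply_inv hdx.ne' (z - x), norm_eq_zero.1 h0.symm, map_zero]
      rw [hρ', ← neg_sub, h1, neg_zero, map_zero, norm_zero]; positivity
    · have hp : ∀ e : ℝ, |e| = 1 → z + e • ((2 * ρ)⁻¹ • (x - z)) ∈ K := by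
        intro e he
        refine hxmem _ ?_
        have e1 : z + e • ((2 * ρ)⁻¹ • (x - z)) - x = (z - x) - (e * (2 * ρ)⁻¹) • (z - x) := by
          module
        rw [e1, map_sub, map_smul]
        refine (norm_sub_le _ _).trans ?_
        rw [norm_smul, ← hρ, Real.norm_eq_abs, abs_mul, he, abs_of_pos (by positivity), one_mul,
          mul_inv, mul_assoc, inv_mul_cancel₀ h0.ne']
        linarith
      have h := norm_johnMatrix_inv_le hn hK hKc hzK (p := (2 * ρ)⁻¹ • (x - z))
        (by simpa only [one_smul] using hp 1 abs_one)
        (by simpa only [neg_one_smul, ← sub_eq_add_neg] using hp (-1) (by simp))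
      rw [map_smul, norm_smul, ← hEz, ← hρ', Real.norm_of_nonneg (by positivity),
        inv_mul_le_iff₀ (by positivity)] at h
      linarith
  have hMinv : (Ex⁻¹ * Ez)⁻¹ = Ez⁻¹ * Ex := by
    rw [Matrix.mul_inv_rev, Matrix.nonsing_inv_nonsing_inv _ (isUnit_iff_ne_zero.2 hdx.ne')]
  have hMdet : (Ex⁻¹ * Ez).det ≠ 0 := by
    rw [Matrix.det_mul]
    exact mul_ne_zero ((Matrix.isUnit_nonsing_inv_det _ (isUnit_iff_ne_zero.2 hdx.ne')).ne_zero)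
      hdz.ne'
  obtain ⟨Q, hQ, hMQ⟩ := exists_orthogonal_norm_le_of_trace_le hMdet
  have hQt : Q.transpose.transpose * Q.transpose = 1 := by
    rw [Matrix.transpose_transpose]; exact mul_eq_one_comm.1 hQ
  have ht1 : (Ex⁻¹ * Ez * Q.transpose).trace ≤ n + Real.sqrt n * ρ := by
    rw [Matrix.mul_assoc]
    refine trace_johnMatrix_inv_mul_le hn hK hKc hx fun u hu => ?_
    rw [toEuclideanLin_mul_apply]
    exact add_johnMatrix_mem hK hKc hzK (by rwa [norm_toEuclideanLin_orthogonal hQt])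
  have ht2 : ((Ex⁻¹ * Ez)⁻¹ * Q).trace ≤ n + Real.sqrt n * ρ' := by
    rw [hMinv, Matrix.mul_assoc]
    refine trace_johnMatrix_inv_mul_le hn hK hKc hzK fun u hu => ?_
    rw [toEuclideanLin_mul_apply]
    exact add_johnMatrix_mem hK hKc hx (by rwa [norm_toEuclideanLin_orthogonal hQ])
  -- The crude bound already confines the singular values of `E_x⁻¹ E_z` to `[1 / 2, 2]`.
  have hρ'2 : ρ' ≤ 2 * ρ := by
    have h1 : Real.sqrt n * ρ' ≤ 2 * (n * (Real.sqrt n * ρ)) := by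
      calc Real.sqrt n * ρ' ≤ Real.sqrt n * (2 * n * ρ) := by gcongr
        _ = _ := by ring
    have h2 := (hMQ (1 / 2) 2 (by norm_num) (by norm_num) (by linarith)
      (Ex⁻¹.toEuclideanLin (x - z))).2
    rw [hMinv, toEuclideanLin_mul_apply, toEuclideanLin_apply_inv hdx.ne', ← hρ', ← neg_sub z x,
      map_neg, norm_neg] at h2
    exact h2
  intro u
  rw [← hMinv]
  refine hMQ (3 * (Real.sqrt n * ρ)) (1 + 1 / (20 * n)) ?_ ?_ ?_ u
  · have : (0 : ℝ) ≤ 1 / (20 * n) := by positivity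
    linarith
  · have e : 1 + 1 / (20 * (n : ℝ)) + (1 + 1 / (20 * (n : ℝ)))⁻¹ - 2
        = 1 / (20 * n * (20 * n + 1)) := by
      field_simp; ring
    rw [e, le_div_iff₀ (by positivity)]
    nlinarith
  · have : Real.sqrt n * ρ' ≤ Real.sqrt n * (2 * ρ) := by gcongr
    linarith

/-! ### Second moments on a ball and the core of a lens -/

lemma setLIntegral_inner_sq_eq {e e' : EuclideanSpace ℝ (Fin n)} (h : ‖e‖ = ‖e'‖) (R : ℝ) :
    ∫⁻ w in Metric.closedBall (0 : EuclideanSpace ℝ (Fin n)) R, ENNReal.ofReal ((inner ℝ w e) ^ 2) =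
      ∫⁻ w in Metric.closedBall (0 : EuclideanSpace ℝ (Fin n)) R,
        ENNReal.ofReal ((inner ℝ w e') ^ 2) := by
  set f := (Submodule.span ℝ {e - e'})ᗮ.reflection with hf
  have hfe : f e = e' := Submodule.reflection_sub h
  have h1 := f.measurePreserving.setLIntegral_comp_preimage_emb
    f.toHomeomorph.measurableEmbedding (fun w => ENNReal.ofReal ((inner ℝ w e') ^ 2))
    (Metric.closedBall 0 R)
  rw [← h1, f.preimage_closedBall, map_zero]
  refine lintegral_congr fun w => ?_
  rw [← hfe, f.inner_map_map]

/-- By rotation invariance, the coordinates of a uniform point of a ball in `n` dimensions all have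
the same second moment, hence one bounded by `R ^ 2 / n`. -/
lemma setLIntegral_inner_sq_le (m : EuclideanSpace ℝ (Fin n)) (R : ℝ) :
    n * ∫⁻ w in Metric.closedBall (0 : EuclideanSpace ℝ (Fin n)) R,
      ENNReal.ofReal ((inner ℝ w m) ^ 2) ≤
      ENNReal.ofReal (‖m‖ ^ 2 * R ^ 2) *
        volume (Metric.closedBall (0 : EuclideanSpace ℝ (Fin n)) R) := by
  have h1 : ∀ i : Fin n, ∫⁻ w in Metric.closedBall (0 : EuclideanSpace ℝ (Fin n)) R,
      ENNReal.ofReal ((inner ℝ w m) ^ 2) =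
      ∫⁻ w in Metric.closedBall (0 : EuclideanSpace ℝ (Fin n)) R,
        ENNReal.ofReal (‖m‖ ^ 2 * w.ofLp i ^ 2) := fun i => by
    rw [setLIntegral_inner_sq_eq (e' := ‖m‖ • EuclideanSpace.single i 1) (by simp [norm_smul])]
    refine lintegral_congr fun w => ?_
    congr 1
    rw [inner_smul_right, EuclideanSpace.inner_single_right]
    simp [mul_pow]
  have h2 : (n : ℝ≥0∞) * ∫⁻ w in Metric.closedBall (0 : EuclideanSpace ℝ (Fin n)) R,
      ENNReal.ofReal ((inner ℝ w m) ^ 2) =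
      ∑ i : Fin n, ∫⁻ w in Metric.closedBall (0 : EuclideanSpace ℝ (Fin n)) R,
        ENNReal.ofReal (‖m‖ ^ 2 * w.ofLp i ^ 2) := by
    rw [Finset.sum_congr rfl fun i _ => (h1 i).symm]; simp
  rw [h2, ← lintegral_finsetSum _ fun i _ => by fun_prop]
  calc ∫⁻ w in Metric.closedBall (0 : EuclideanSpace ℝ (Fin n)) R,
        ∑ i : Fin n, ENNReal.ofReal (‖m‖ ^ 2 * w.ofLp i ^ 2)
      ≤ ∫⁻ _ in Metric.closedBall (0 : EuclideanSpace ℝ (Fin n)) R,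
        ENNReal.ofReal (‖m‖ ^ 2 * R ^ 2) := by
        refine setLIntegral_mono' measurableSet_closedBall fun w hw => ?_
        rw [← ENNReal.ofReal_sum_of_nonneg fun i _ => by positivity, ← Finset.mul_sum,
          ← EuclideanSpace.real_norm_sq_eq]
        refine ENNReal.ofReal_le_ofReal ?_
        gcongr
        simpa using hw
    _ = _ := setLIntegral_const _ _

/-- Chebyshev's inequality for a linear functional on a ball. -/
lemma volume_le_abs_inner_le (hn : 1 ≤ n) (m : EuclideanSpace ℝ (Fin n)) (R : ℝ) {τ : ℝ}
    (hτ : 0 < τ) :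
    volume (Metric.closedBall (0 : EuclideanSpace ℝ (Fin n)) R ∩ {w | τ ≤ |inner ℝ w m|}) ≤
      ENNReal.ofReal (‖m‖ ^ 2 * R ^ 2 / (n * τ ^ 2)) *
        volume (Metric.closedBall (0 : EuclideanSpace ℝ (Fin n)) R) := by
  have hn0 : (0 : ℝ) < n := by exact_mod_cast hn
  have h1 := mul_meas_ge_le_lintegral₀
    (μ := volume.restrict (Metric.closedBall (0 : EuclideanSpace ℝ (Fin n)) R))
    (f := fun w => ENNReal.ofReal ((inner ℝ w m) ^ 2))
    (Measurable.aemeasurable (by fun_prop)) (ENNReal.ofReal (τ ^ 2))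
  have h2 : {w : EuclideanSpace ℝ (Fin n) | ENNReal.ofReal (τ ^ 2) ≤
      ENNReal.ofReal ((inner ℝ w m) ^ 2)} = {w | τ ≤ |inner ℝ w m|} := by
    ext w
    rw [mem_ofPred_eq, mem_ofPred_eq, ENNReal.ofReal_le_ofReal_iff (sq_nonneg _), sq_le_sq,
      abs_of_pos hτ]
  rw [h2, Measure.restrict_apply' measurableSet_closedBall, inter_comm] at h1
  have h3 := (mul_le_mul_right h1 (n : ℝ≥0∞)).trans (setLIntegral_inner_sq_le m R)
  rw [← mul_assoc, ← ENNReal.ofReal_natCast, ← ENNReal.ofReal_mul hn0.le] at h3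
  rw [div_eq_inv_mul, ENNReal.ofReal_mul (by positivity), mul_assoc,
    ENNReal.ofReal_inv_of_pos (by positivity), mul_comm, ← div_eq_mul_inv,
    ENNReal.le_div_iff_mul_le (Or.inl (ENNReal.ofReal_pos.2 (by positivity)).ne')
      (Or.inl ENNReal.ofReal_ne_top),
    mul_comm]
  exact h3

/-- A slightly shrunken ball, cut by a slab. For `‖m‖ ≤ 1 / (8 √n)` it lies inside the lens
`{‖w + m‖ ≤ 1, ‖w - m‖ ≤ 1}`, with a margin of order `1 / n` (`norm_sq_le_of_mem_lensCore`): the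
width of the slab keeps the cross term of `‖w ± m‖ ^ 2` of order `1 / n`, and the shrinking
of the ball absorbs it. -/
def lensCore (m : EuclideanSpace ℝ (Fin n)) : Set (EuclideanSpace ℝ (Fin n)) :=
  Metric.closedBall 0 (1 - 3 / (8 * n)) ∩ {w | |inner ℝ w m| ≤ 15 / (64 * n)}

lemma isCompact_lensCore (m : EuclideanSpace ℝ (Fin n)) : IsCompact (lensCore m) :=
  (isCompact_closedBall _ _).inter_right (isClosed_le (by fun_prop) continuous_const)

lemma norm_sq_le_of_mem_lensCore (hn : 1 ≤ n) {m w : EuclideanSpace ℝ (Fin n)}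
    (hm : n * ‖m‖ ^ 2 ≤ 1 / 64) (hw : w ∈ lensCore m) :
    ‖w + m‖ ^ 2 ≤ 1 - 1 / (8 * n) ∧ ‖w - m‖ ^ 2 ≤ 1 - 1 / (8 * n) := by
  have hn1 : (1 : ℝ) ≤ n := by exact_mod_cast hn
  obtain ⟨a, ha⟩ : ∃ a : ℝ, a = 1 / n := ⟨_, rfl⟩
  have ha0 : 0 < a := by rw [ha]; positivity
  have ha1 : a ≤ 1 := by rw [ha]; exact (div_le_one (by linarith)).2 hn1
  have hna : n * a = 1 := by rw [ha]; field_simp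
  have h1 : ‖w‖ ≤ 1 - 3 / 8 * a := by
    have : ‖w‖ ≤ 1 - 3 / (8 * n) := by simpa using hw.1
    rw [ha]; convert this using 2; field_simp
  have h2 : |inner ℝ w m| ≤ 15 / 64 * a := by
    have : |inner ℝ w m| ≤ 15 / (64 * n) := hw.2
    rw [ha]; convert this using 1; field_simp
  have h3 : ‖m‖ ^ 2 ≤ 1 / 64 * a := by
    calc ‖m‖ ^ 2 = n * ‖m‖ ^ 2 * a := by rw [mul_right_comm, hna, one_mul]
      _ ≤ _ := by gcongr
  have h4 : ‖w‖ ^ 2 ≤ 1 - 39 / 64 * a := by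
    calc ‖w‖ ^ 2 ≤ (1 - 3 / 8 * a) ^ 2 := by gcongr
      _ ≤ _ := by nlinarith
  have h5 : 1 / (8 * (n : ℝ)) = 1 / 8 * a := by rw [ha]; field_simp
  rw [h5, norm_add_sq_real, norm_sub_sq_real]
  have := abs_le.1 h2
  constructor <;> linarith [this.1, this.2]

lemma le_volume_lensCore (hn : 1 ≤ n) {m : EuclideanSpace ℝ (Fin n)}
    (hm : n * ‖m‖ ^ 2 ≤ 1 / 64) :
    ENNReal.ofReal (2 / 5) * volume (Metric.closedBall (0 : EuclideanSpace ℝ (Fin n)) 1) ≤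
      volume (lensCore m) := by
  have hn1 : (1 : ℝ) ≤ n := by exact_mod_cast hn
  have hn0 : (0 : ℝ) < n := by linarith
  set R : ℝ := 1 - 3 / (8 * n) with hR
  have hdiv : 3 / (8 * (n : ℝ)) ≤ 3 / 8 := by
    rw [div_le_div_iff₀ (by positivity) (by norm_num)]; linarith
  have hdiv0 : 0 < 3 / (8 * (n : ℝ)) := by positivity
  have hR0 : 0 < R := by linarith
  have hR1 : R ≤ 1 := by linarith
  have hRn : 5 / 8 ≤ R ^ n := by
    have := one_add_mul_le_pow (show (-2 : ℝ) ≤ -(3 / (8 * n)) by linarith) n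
    calc (5 : ℝ) / 8 = 1 + n * -(3 / (8 * n)) := by field_simp; norm_num
      _ ≤ _ := this
      _ = R ^ n := by rw [hR, sub_eq_add_neg]
  set b := volume (Metric.closedBall (0 : EuclideanSpace ℝ (Fin n)) 1) with hb
  have hbt : b ≠ ⊤ := measure_closedBall_lt_top.ne
  have hBR : volume (Metric.closedBall (0 : EuclideanSpace ℝ (Fin n)) R) =
      ENNReal.ofReal (R ^ n) * b := by
    have := Measure.addHaar_closedBall_mul (volume : Measure (EuclideanSpace ℝ (Fin n))) 0 hR0.le
      zero_le_one
    rwa [mul_one, finrank_euclideanSpace_fin] at this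
  set S := Metric.closedBall (0 : EuclideanSpace ℝ (Fin n)) R ∩
    {w | 15 / (64 * (n : ℝ)) ≤ |inner ℝ w m|} with hS
  have hslab : volume S ≤ ENNReal.ofReal (64 / 225 * R ^ n) * b := by
    refine (volume_le_abs_inner_le hn m R (by positivity)).trans ?_
    rw [hBR, ← mul_assoc, ← ENNReal.ofReal_mul (by positivity)]
    refine mul_le_mul_left (ENNReal.ofReal_le_ofReal ?_) _
    refine mul_le_mul_of_nonneg_right ?_ (by positivity)
    rw [div_le_iff₀ (by positivity)]
    have e : 64 / 225 * ((n : ℝ) * (15 / (64 * n)) ^ 2) = 1 / (64 * n) := by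
      field_simp; norm_num
    rw [e, le_div_iff₀ (by positivity)]
    have : R ^ 2 ≤ 1 := pow_le_one₀ hR0.le hR1
    nlinarith [mul_nonneg hn0.le (sq_nonneg ‖m‖)]
  have hcover : volume (Metric.closedBall (0 : EuclideanSpace ℝ (Fin n)) R) ≤
      volume (lensCore m) + volume S := by
    refine (measure_mono fun w hw => ?_).trans (measure_union_le _ _)
    rcases le_total |inner ℝ w m| (15 / (64 * (n : ℝ))) with h | h
    · exact Or.inl ⟨hw, h⟩
    · exact Or.inr ⟨hw, h⟩
  rw [hBR] at hcover
  have h1 : ENNReal.ofReal (2 / 5) * b + ENNReal.ofReal (64 / 225 * R ^ n) * b ≤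
      volume (lensCore m) + ENNReal.ofReal (64 / 225 * R ^ n) * b := by
    refine le_trans ?_ (hcover.trans (by gcongr))
    rw [← add_mul, ← ENNReal.ofReal_add (by norm_num) (by positivity)]
    gcongr
    nlinarith
  exact (ENNReal.add_le_add_iff_right (ENNReal.mul_ne_top ENNReal.ofReal_ne_top hbt)).1 h1

/-! ### Total variation distance and the transition measure -/

/-- Two probability measures that dominate a common measure of mass `g` are at total variation
distance at most `1 - g`. -/
lemma tvDist_le_of_le {Ω : Type*} [MeasurableSpace Ω] {P Q ν : Measure Ω} [IsProbabilityMeasure P]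
    [IsProbabilityMeasure Q] (hP : ν ≤ P) (hQ : ν ≤ Q) {g : ℝ}
    (hg : ENNReal.ofReal g ≤ ν univ) : tvDist P Q ≤ 1 - g := by
  have hfin : IsFiniteMeasure ν := ⟨(hP univ).trans_lt (measure_lt_top P univ)⟩
  have hg' : g ≤ ν.real univ := (ENNReal.ofReal_le_iff_le_toReal (measure_ne_top ν univ)).1 hg
  have hmono : ∀ (P' : Measure Ω) [IsProbabilityMeasure P'], ν ≤ P' → ∀ A, ν.real A ≤ P'.real A :=
    fun P' _ h A => ENNReal.toReal_mono (measure_ne_top _ _) (h A)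
  have : Nonempty {A : Set Ω // MeasurableSet A} := ⟨⟨∅, MeasurableSet.empty⟩⟩
  refine ciSup_le fun A => ?_
  have h0 := measureReal_add_measureReal_compl (μ := ν) A.2
  have h1 := probReal_add_probReal_compl (μ := P) A.2
  have h2 := probReal_add_probReal_compl (μ := Q) A.2
  have h3 := hmono P hP A.1
  have h4 := hmono P hP A.1ᶜ
  have h5 := hmono Q hQ A.1
  have h6 := hmono Q hQ A.1ᶜ
  rw [abs_le]
  constructor <;> linarith

lemma tvDist_le_one {Ω : Type*} [MeasurableSpace Ω] (P Q : Measure Ω) [IsProbabilityMeasure P]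
    [IsProbabilityMeasure Q] : tvDist P Q ≤ 1 := by
  have := tvDist_le_of_le (P := P) (Q := Q) (ν := 0) (Measure.zero_le _) (Measure.zero_le _)
    (g := 0) (by simp)
  linarith

section Transition

variable {K : Set (EuclideanSpace ℝ (Fin n))} {r : ℝ} {x : EuclideanSpace ℝ (Fin n)}

lemma isProbabilityMeasure_transition (h0 : volume (johnEllipsoid K r x) ≠ 0)
    (ht : volume (johnEllipsoid K r x) ≠ ⊤) : IsProbabilityMeasure (transition K r x) := by
  have hQ : proposal K r x univ = 1 := by
    simp [proposal, ENNReal.inv_mul_cancel h0 ht]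
  have hle : ∫⁻ z, acceptance K r x z ∂(proposal K r x) ≤ 1 := by
    calc ∫⁻ z, acceptance K r x z ∂(proposal K r x) ≤ ∫⁻ _, 1 ∂(proposal K r x) := by
          refine lintegral_mono fun z => ?_
          unfold acceptance
          exact indicator_apply_le' (fun _ => min_le_left _ _) (fun _ => zero_le_one)
      _ = 1 := by rw [lintegral_one, hQ]
  refine ⟨?_⟩
  rw [transition, Measure.add_apply, withDensity_apply _ MeasurableSet.univ, setLIntegral_univ,
    Measure.smul_apply, measure_univ, smul_eq_mul, mul_one, add_tsub_cancel_of_le hle]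

/-- On a set `G` of proposals that the walk can accept, the transition measure has density at least
`min (1 / vol E_x(r)) (1 / vol E_z(r))`. -/
lemma smul_restrict_le_transition (h0 : volume (johnEllipsoid K r x) ≠ 0)
    (ht : volume (johnEllipsoid K r x) ≠ ⊤) {G : Set (EuclideanSpace ℝ (Fin n))}
    (hG : MeasurableSet G) (hGx : G ⊆ johnEllipsoid K r x)
    (hxG : ∀ z ∈ G, x ∈ johnEllipsoid K r z) {g : ℝ≥0∞}
    (hg : g ≤ (volume (johnEllipsoid K r x))⁻¹)
    (hgG : ∀ z ∈ G, g ≤ (volume (johnEllipsoid K r z))⁻¹) :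
    g • volume.restrict G ≤ transition K r x := by
  refine le_trans (Measure.le_iff.2 fun S hS => ?_) (Measure.le_add_right le_rfl)
  rw [withDensity_apply _ hS, proposal, Measure.restrict_smul, lintegral_smul_measure,
    Measure.restrict_restrict hS, Measure.smul_apply, Measure.restrict_apply hS, smul_eq_mul,
    smul_eq_mul]
  calc g * volume (S ∩ G) = ∫⁻ _ in S ∩ G, g := (setLIntegral_const _ _).symm
    _ ≤ ∫⁻ z in S ∩ G, (volume (johnEllipsoid K r x))⁻¹ * acceptance K r x z := by
        refine setLIntegral_mono' (hS.inter hG) fun z hz => ?_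
        have hacc : acceptance K r x z = min 1 (volume (johnEllipsoid K r x) /
            volume (johnEllipsoid K r z)) :=
          indicator_of_mem (s := {z | x ∈ johnEllipsoid K r z}) (a := z) (hxG z hz.2) _
        rw [hacc]
        rcases min_choice 1 (volume (johnEllipsoid K r x) / volume (johnEllipsoid K r z))
          with h | h
        · rwa [h, mul_one]
        · rw [h, div_eq_mul_inv, ← mul_assoc, ENNReal.inv_mul_cancel h0 ht, one_mul]
          exact hgG z hz.2
    _ = (volume (johnEllipsoid K r x))⁻¹ * ∫⁻ z in S ∩ G, acceptance K r x z :=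
        lintegral_const_mul' _ _ (ENNReal.inv_ne_top.2 h0)
    _ ≤ _ := by
        refine mul_le_mul_right ?_ _
        exact lintegral_mono' (Measure.restrict_mono (inter_subset_inter_right _ hGx) le_rfl)
          le_rfl

end Transition

/-! ### Overlap of the transition measures -/

lemma abs_det_le_pow {M : Matrix (Fin n) (Fin n) ℝ} {b : ℝ} (hb : 0 ≤ b)
    (hM : ∀ u, ‖M.toEuclideanLin u‖ ≤ b * ‖u‖) : |M.det| ≤ b ^ n := by
  have hsub : M.toEuclideanLin '' Metric.closedBall 0 1 ⊆ Metric.closedBall 0 b := by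
    rintro _ ⟨u, hu, rfl⟩
    have hu' : ‖u‖ ≤ 1 := by simpa using hu
    rw [mem_closedBall_zero_iff]
    exact (hM u).trans (mul_le_of_le_one_right hb hu')
  have h := measure_mono (μ := volume) hsub
  have hB := Measure.addHaar_closedBall_mul (volume : Measure (EuclideanSpace ℝ (Fin n))) 0 hb
    zero_le_one
  rw [mul_one, finrank_euclideanSpace_fin] at hB
  rw [Measure.addHaar_image_linearMap, det_toEuclideanLin, hB, ENNReal.mul_le_mul_iff_left
    (Metric.measure_closedBall_pos _ _ one_pos).ne' measure_closedBall_lt_top.ne,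
    ENNReal.ofReal_le_ofReal_iff (by positivity)] at h
  exact h

lemma one_add_div_pow_le (hn : 1 ≤ n) : (1 + 1 / (20 * (n : ℝ))) ^ n ≤ 20 / 19 := by
  have hn0 : (0 : ℝ) < n := by exact_mod_cast hn
  calc (1 + 1 / (20 * (n : ℝ))) ^ n ≤ (Real.exp (1 / (20 * n))) ^ n := by
        gcongr
        rw [add_comm]; exact Real.add_one_le_exp _
    _ = Real.exp (1 / 20) := by
        rw [← Real.exp_nat_mul]; congr 1; field_simp
    _ ≤ 20 / 19 := by
        have h1 := Real.one_sub_le_exp_neg (1 / 20)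
        rw [Real.exp_neg, le_inv_comm₀ (by norm_num) (Real.exp_pos _)] at h1
        exact h1.trans (by norm_num)

lemma localNorm_eq {K : Set (EuclideanSpace ℝ (Fin n))} {x : EuclideanSpace ℝ (Fin n)}
    (hE : (johnMatrix K x).PosDef) (v : EuclideanSpace ℝ (Fin n)) :
    localNorm K x v = ‖(johnMatrix K x)⁻¹.toEuclideanLin v‖ := by
  have ht : (johnMatrix K x)⁻¹.transpose = (johnMatrix K x)⁻¹ := by
    rw [← Matrix.conjTranspose_eq_transpose_of_trivial]; exact hE.1.inv
  rw [localNorm, sq, ← Real.sqrt_sq (norm_nonneg _), norm_toEuclideanLin_sq, ht]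

lemma mem_johnEllipsoid {K : Set (EuclideanSpace ℝ (Fin n))} {r : ℝ} (hr : 0 < r)
    {x z : EuclideanSpace ℝ (Fin n)} (hE : (johnMatrix K x).det ≠ 0) :
    z ∈ johnEllipsoid K r x ↔ ‖(johnMatrix K x)⁻¹.toEuclideanLin (z - x)‖ ≤ r := by
  constructor
  · rintro ⟨u, hu, rfl⟩
    have hu' : ‖u‖ ≤ 1 := by simpa using hu
    simp only [add_sub_cancel_right]
    rw [map_smul, LinearMap.smul_apply, map_smul, toEuclideanLin_inv_apply hE, norm_smul,
      Real.norm_of_nonneg hr.le]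
    exact mul_le_of_le_one_right hr.le hu'
  · intro h
    refine ⟨r⁻¹ • (johnMatrix K x)⁻¹.toEuclideanLin (z - x), ?_, ?_⟩
    · rw [mem_closedBall_zero_iff, norm_smul, Real.norm_of_nonneg (by positivity),
        inv_mul_le_iff₀ hr, mul_one]
      exact h
    · simp only
      rw [map_smul, map_smul Matrix.toEuclideanLin, LinearMap.smul_apply,
        toEuclideanLin_apply_inv hE, smul_smul, inv_mul_cancel₀ hr.ne', one_smul, sub_add_cancel]

lemma volume_johnEllipsoid (K : Set (EuclideanSpace ℝ (Fin n))) {r : ℝ} (hr : 0 < r)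
    {x : EuclideanSpace ℝ (Fin n)} (hE : 0 < (johnMatrix K x).det) :
    volume (johnEllipsoid K r x) = ENNReal.ofReal (r ^ n * (johnMatrix K x).det) *
      volume (Metric.closedBall (0 : EuclideanSpace ℝ (Fin n)) 1) := by
  rw [johnEllipsoid, volume_ellipsoid, Matrix.det_smul, Fintype.card_fin,
    abs_of_pos (by positivity)]

lemma volume_johnEllipsoid_ne {K : Set (EuclideanSpace ℝ (Fin n))} {r : ℝ} (hr : 0 < r)
    {x : EuclideanSpace ℝ (Fin n)} (hE : 0 < (johnMatrix K x).det) :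
    volume (johnEllipsoid K r x) ≠ 0 ∧ volume (johnEllipsoid K r x) ≠ ⊤ := by
  rw [volume_johnEllipsoid K hr hE]
  exact ⟨mul_ne_zero (ENNReal.ofReal_pos.2 (by positivity)).ne'
    (Metric.measure_closedBall_pos _ _ one_pos).ne',
    ENNReal.mul_ne_top ENNReal.ofReal_ne_top measure_closedBall_lt_top.ne⟩

lemma isProbabilityMeasure_transition_of_mem_interior {K : Set (EuclideanSpace ℝ (Fin n))}
    (hK : Convex ℝ K) (hKc : IsCompact K) {r : ℝ} (hr : 0 < r) {x : EuclideanSpace ℝ (Fin n)}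
    (hx : x ∈ interior K) : IsProbabilityMeasure (transition K r x) :=
  have h := volume_johnEllipsoid_ne hr (posDef_johnMatrix hK hKc hx).det_pos
  isProbabilityMeasure_transition h.1 h.2

lemma det_johnMatrix_le (hn : 1 ≤ n) {K : Set (EuclideanSpace ℝ (Fin n))}
    {x z : EuclideanSpace ℝ (Fin n)} (hx : 0 < (johnMatrix K x).det)
    (h : ∀ u : EuclideanSpace ℝ (Fin n),
      ‖((johnMatrix K x)⁻¹ * johnMatrix K z).toEuclideanLin u‖ ≤ (1 + 1 / (20 * n)) * ‖u‖) :
    (johnMatrix K z).det ≤ 20 / 19 * (johnMatrix K x).det := by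
  have h1 := (abs_det_le_pow (by positivity) h).trans (one_add_div_pow_le hn)
  rw [← Matrix.mul_nonsing_inv_cancel_left (johnMatrix K x) (johnMatrix K z)
    (isUnit_iff_ne_zero.2 hx.ne'), Matrix.det_mul, mul_comm]
  exact mul_le_mul_of_nonneg_right ((le_abs_self _).trans h1) hx.le

/-- One step of the walk from `x` and from a point `y` at local distance at most `r / (4 √n)` have
a common component of mass `1 / 4`: both transition measures have a density bounded below on the
image of `lensCore` under the affine map that sends the unit ball to the translate of `E_x(r)`
centred at the midpoint of `x` and `y`. -/
lemma tvDist_transition_le (hn : 1 ≤ n) {K : Set (EuclideanSpace ℝ (Fin n))} (hK : Convex ℝ K)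
    (hKc : IsCompact K) {x y : EuclideanSpace ℝ (Fin n)} (hx : x ∈ interior K) {r : ℝ} (hr : 0 < r)
    (hrn : (n : ℝ) ^ 2 * Real.sqrt n * r ≤ 1 / 10000)
    (hxy : 4 * Real.sqrt n * ‖(johnMatrix K x)⁻¹.toEuclideanLin (y - x)‖ ≤ r) :
    tvDist (transition K r x) (transition K r y) ≤ 3 / 4 := by
  have hn1 : (1 : ℝ) ≤ n := by exact_mod_cast hn
  have hn0 : (0 : ℝ) < n := by linarith
  have hs1 : 1 ≤ Real.sqrt n := Real.one_le_sqrt.2 hn1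
  have hss : Real.sqrt n ^ 2 = n := Real.sq_sqrt hn0.le
  have hstab : ∀ z, ‖(johnMatrix K x)⁻¹.toEuclideanLin (z - x)‖ ≤ r →
      z ∈ interior K ∧ ∀ u : EuclideanSpace ℝ (Fin n),
        ‖((johnMatrix K x)⁻¹ * johnMatrix K z).toEuclideanLin u‖ ≤ (1 + 1 / (20 * n)) * ‖u‖ ∧
        ‖((johnMatrix K z)⁻¹ * johnMatrix K x).toEuclideanLin u‖ ≤ (1 + 1 / (20 * n)) * ‖u‖ :=
    fun z hz => johnMatrix_stability hn hK hKc hx (le_trans (by gcongr) hrn)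
  have hdpos : ∀ z ∈ interior K, 0 < (johnMatrix K z).det :=
    fun z hz => (posDef_johnMatrix hK hKc hz).det_pos
  have hdx := hdpos x hx
  set E := johnMatrix K x with hE
  set m := (2 * r)⁻¹ • E⁻¹.toEuclideanLin (y - x) with hm
  have hEy : E⁻¹.toEuclideanLin (y - x) = r • ((2 : ℝ) • m) := by
    rw [hm, smul_smul, smul_smul, show r * 2 * (2 * r)⁻¹ = 1 by field_simp, one_smul]
  have hmn : n * ‖m‖ ^ 2 ≤ 1 / 64 := by
    rw [hEy, norm_smul, norm_smul, Real.norm_of_nonneg hr.le, Real.norm_two] at hxy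
    have h1 : Real.sqrt n * ‖m‖ ≤ 1 / 8 := by
      refine le_of_mul_le_mul_left (a := r) ?_ hr
      linarith
    calc n * ‖m‖ ^ 2 = (Real.sqrt n * ‖m‖) ^ 2 := by rw [mul_pow, hss]
      _ ≤ (1 / 8) ^ 2 := by gcongr
      _ = 1 / 64 := by norm_num
  have hyr : ‖E⁻¹.toEuclideanLin (y - x)‖ ≤ r := by
    refine le_trans ?_ hxy
    exact le_mul_of_one_le_left (norm_nonneg _) (by linarith)
  obtain ⟨hyK, hyE⟩ := hstab y hyr
  have hdy := hdpos y hyK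
  have hshrink : (1 + 1 / (20 * (n : ℝ))) ^ 2 * (1 - 1 / (8 * n)) ≤ 1 := by
    obtain ⟨a, ha⟩ : ∃ a : ℝ, a = 1 / (40 * n) := ⟨_, rfl⟩
    have ha0 : 0 < a := by rw [ha]; positivity
    rw [show 1 / (20 * (n : ℝ)) = 2 * a by rw [ha]; field_simp; norm_num,
      show 1 / (8 * (n : ℝ)) = 5 * a by rw [ha]; field_simp; norm_num]
    nlinarith [pow_pos ha0 2, pow_pos ha0 3]
  -- Points of the lens stay within distance `r` when measured with a nearby ellipsoid.
  have hnear : ∀ (q : EuclideanSpace ℝ (Fin n)) (p w : EuclideanSpace ℝ (Fin n)),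
      (∀ u : EuclideanSpace ℝ (Fin n),
        ‖((johnMatrix K q)⁻¹ * E).toEuclideanLin u‖ ≤ (1 + 1 / (20 * n)) * ‖u‖) →
      p = r • E.toEuclideanLin w → ‖w‖ ^ 2 ≤ 1 - 1 / (8 * n) →
      ‖(johnMatrix K q)⁻¹.toEuclideanLin p‖ ≤ r := by
    rintro q p w hq rfl hw
    rw [map_smul, ← toEuclideanLin_mul_apply, norm_smul, Real.norm_of_nonneg hr.le]
    refine mul_le_of_le_one_right hr.le ((hq w).trans ?_)
    rw [← sq_le_one_iff₀ (by positivity), mul_pow]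
    exact le_trans (by gcongr) hshrink
  have hself : ∀ u : EuclideanSpace ℝ (Fin n),
      ‖((johnMatrix K x)⁻¹ * E).toEuclideanLin u‖ ≤ (1 + 1 / (20 * n)) * ‖u‖ := fun u => by
    rw [← hE, Matrix.nonsing_inv_mul _ (isUnit_iff_ne_zero.2 hdx.ne'), toEuclideanLin_one_apply]
    exact le_mul_of_one_le_left (norm_nonneg _) (le_add_of_nonneg_right (by positivity))
  set G : Set (EuclideanSpace ℝ (Fin n)) :=
    (fun w => (x + r • E.toEuclideanLin m) + (r • E).toEuclideanLin w) '' lensCore m with hG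
  have hyx : y - x = r • E.toEuclideanLin ((2 : ℝ) • m) := by
    rw [← map_smul, ← hEy, toEuclideanLin_apply_inv hdx.ne']
  have hGform : ∀ z ∈ G, ∃ w ∈ lensCore m, z - x = r • E.toEuclideanLin (w + m) ∧
      z - y = r • E.toEuclideanLin (w - m) := by
    rintro _ ⟨w, hw, rfl⟩
    refine ⟨w, hw, ?_, ?_⟩
    · simp only [map_smul, LinearMap.smul_apply, map_add, smul_add]
      abel
    · rw [show y = x + r • E.toEuclideanLin ((2 : ℝ) • m) by rw [← hyx]; abel]
      simp only [map_smul, LinearMap.smul_apply, map_sub]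
      module
  have hGz : ∀ z ∈ G, ‖E⁻¹.toEuclideanLin (z - x)‖ ≤ r ∧ z ∈ johnEllipsoid K r x ∧
      z ∈ johnEllipsoid K r y ∧ x ∈ johnEllipsoid K r z ∧ y ∈ johnEllipsoid K r z := by
    intro z hz
    obtain ⟨w, hw, h1, h2⟩ := hGform z hz
    obtain ⟨hp, hq⟩ := norm_sq_le_of_mem_lensCore hn hmn hw
    have hzx := hnear x (z - x) _ hself h1 hp
    obtain ⟨hzK, hzE⟩ := hstab z hzx
    have hdz := hdpos z hzK
    refine ⟨hzx, (mem_johnEllipsoid hr hdx.ne').2 hzx, (mem_johnEllipsoid hr hdy.ne').2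
      (hnear y (z - y) _ (fun u => (hyE u).2) h2 hq), (mem_johnEllipsoid hr hdz.ne').2 ?_,
      (mem_johnEllipsoid hr hdz.ne').2 ?_⟩
    · rw [← neg_sub, map_neg, norm_neg]
      exact hnear z (z - x) _ (fun u => (hzE u).2) h1 hp
    · rw [← neg_sub, map_neg, norm_neg]
      exact hnear z (z - y) _ (fun u => (hzE u).2) h2 hq
  have hGm : MeasurableSet G := by
    have hc : Continuous (r • E).toEuclideanLin := LinearMap.continuous_of_finiteDimensional _
    exact ((isCompact_lensCore m).image (continuous_const.add hc)).measurableSet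
  set b := volume (Metric.closedBall (0 : EuclideanSpace ℝ (Fin n)) 1) with hb
  have hb0 : b ≠ 0 := (Metric.measure_closedBall_pos _ _ one_pos).ne'
  have hbt : b ≠ ⊤ := measure_closedBall_lt_top.ne
  set D := r ^ n * E.det with hD
  have hD0 : 0 < D := by positivity
  -- The volumes of `E_x(r)`, `E_y(r)` and `E_z(r)` for `z ∈ G` are all at most `g⁻¹`.
  set g : ℝ≥0∞ := (ENNReal.ofReal (20 / 19 * D) * b)⁻¹ with hg
  have hgle : ∀ z, z ∈ interior K → (johnMatrix K z).det ≤ 20 / 19 * E.det →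
      g ≤ (volume (johnEllipsoid K r z))⁻¹ := by
    intro z hz hdet
    rw [hg, volume_johnEllipsoid K hr (hdpos z hz), ENNReal.inv_le_inv]
    refine mul_le_mul_left (ENNReal.ofReal_le_ofReal ?_) _
    calc r ^ n * (johnMatrix K z).det ≤ r ^ n * (20 / 19 * E.det) := by gcongr
      _ = 20 / 19 * D := by rw [hD]; ring
  have hgG : ∀ z ∈ G, g ≤ (volume (johnEllipsoid K r z))⁻¹ := fun z hz => by
    obtain ⟨hzK, hzE⟩ := hstab z (hGz z hz).1
    exact hgle z hzK (det_johnMatrix_le hn hdx fun u => (hzE u).1)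
  have hPx := isProbabilityMeasure_transition_of_mem_interior hK hKc hr hx
  have hPy := isProbabilityMeasure_transition_of_mem_interior hK hKc hr hyK
  have hvx := volume_johnEllipsoid_ne hr hdx
  have hvy := volume_johnEllipsoid_ne hr hdy
  have hx' : g • volume.restrict G ≤ transition K r x :=
    smul_restrict_le_transition hvx.1 hvx.2 hGm (fun z hz => (hGz z hz).2.1)
      (fun z hz => (hGz z hz).2.2.2.1)
      (hgle x hx (det_johnMatrix_le hn hdx hself)) hgG
  have hy' : g • volume.restrict G ≤ transition K r y :=
    smul_restrict_le_transition hvy.1 hvy.2 hGm (fun z hz => (hGz z hz).2.2.1)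
      (fun z hz => (hGz z hz).2.2.2.2)
      (hgle y hyK (det_johnMatrix_le hn hdx fun u => (hyE u).1)) hgG
  have hmass : ENNReal.ofReal (1 / 4) ≤ (g • volume.restrict G) univ := by
    have hGvol : volume G = ENNReal.ofReal D * volume (lensCore m) := by
      have : G = (fun z => (x + r • E.toEuclideanLin m) + z) ''
          ((r • E).toEuclideanLin '' lensCore m) := by rw [hG, image_image]
      rw [this, image_add_left, measure_preimage_add, Measure.addHaar_image_linearMap,
        det_toEuclideanLin, Matrix.det_smul, Fintype.card_fin, abs_of_pos hD0]
    rw [Measure.smul_apply, Measure.restrict_apply_univ, smul_eq_mul, hg, mul_comm,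
      ← div_eq_mul_inv, ENNReal.le_div_iff_mul_le
        (Or.inl (mul_ne_zero (ENNReal.ofReal_pos.2 (by positivity)).ne' hb0))
        (Or.inl (ENNReal.mul_ne_top ENNReal.ofReal_ne_top hbt)), hGvol]
    calc ENNReal.ofReal (1 / 4) * (ENNReal.ofReal (20 / 19 * D) * b)
        = ENNReal.ofReal (1 / 4 * (20 / 19 * D)) * b := by
          rw [← mul_assoc, ← ENNReal.ofReal_mul (by norm_num)]
      _ ≤ ENNReal.ofReal (D * (2 / 5)) * b := by
          exact mul_le_mul_left (ENNReal.ofReal_le_ofReal (by linarith)) _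
      _ = ENNReal.ofReal D * (ENNReal.ofReal (2 / 5) * b) := by
          rw [ENNReal.ofReal_mul hD0.le, mul_assoc]
      _ ≤ _ := by
          gcongr
          exact le_volume_lensCore hn hmn
  exact (tvDist_le_of_le hx' hy' hmass).trans (by norm_num)

end JohnWalk

theorem mainTheorem2 :
    ∃ c : ℝ, 0 < c ∧ c < 1 ∧
      ∀ (n : ℕ), 1 ≤ n → ∀ (r : ℝ), r = c * (n : ℝ) ^ (-(5 / 2) : ℝ) →
        (∀ t : ℝ, r * t / Real.sqrt n = c * t * (n : ℝ) ^ (-3 : ℝ)) ∧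
        ∀ (K : Set (EuclideanSpace ℝ (Fin n))), Convex ℝ K → IsCompact K →
          ∀ x ∈ interior K, ∀ y ∈ K,
            (∀ t : ℝ, t ≤ 1 → JohnWalk.localNorm K x (y - x) ≤ r * t / Real.sqrt n →
              JohnWalk.tvDist (JohnWalk.transition K r x) (JohnWalk.transition K r y)
                ≤ 3 / 4 + t) ∧
            (JohnWalk.localNorm K x (y - x) ≤ r * (1 / 8) / Real.sqrt n →
              JohnWalk.tvDist (JohnWalk.transition K r x) (JohnWalk.transition K r y)
                ≤ 1 - 1 / 8) := by
  refine ⟨1 / 10000, by norm_num, by norm_num, fun n hn r hr => ?_⟩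
  have hn1 : (1 : ℝ) ≤ n := by exact_mod_cast hn
  have hn0 : (0 : ℝ) < n := by linarith
  have hs1 : 1 ≤ Real.sqrt n := Real.one_le_sqrt.2 hn1
  have hs0 : 0 < Real.sqrt n := by linarith
  have hss : Real.sqrt n ^ 2 = n := Real.sq_sqrt hn0.le
  have hpow : (n : ℝ) ^ (-(5 / 2) : ℝ) = ((n : ℝ) ^ 2 * Real.sqrt n)⁻¹ := by
    rw [Real.rpow_neg hn0.le, Real.sqrt_eq_rpow, ← Real.rpow_natCast, ← Real.rpow_add hn0]
    norm_num
  have hpow3 : (n : ℝ) ^ (-3 : ℝ) = ((n : ℝ) ^ 2 * Real.sqrt n ^ 2)⁻¹ := by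
    rw [hss, ← pow_succ, Real.rpow_neg hn0.le, ← Real.rpow_natCast]
    norm_num
  rw [hpow] at hr
  have hr0 : 0 < r := by rw [hr]; positivity
  have hrn : (n : ℝ) ^ 2 * Real.sqrt n * r ≤ 1 / 10000 := by
    rw [hr]; apply le_of_eq; field_simp
  have hr1 : r < 1 := by
    have : 1 ≤ (n : ℝ) ^ 2 * Real.sqrt n := one_le_mul_of_one_le_of_one_le (one_le_pow₀ hn1) hs1
    nlinarith
  refine ⟨fun t => by rw [hr, hpow3]; field_simp, fun K hK hKc x hx y _ => ?_⟩
  have hnorm := JohnWalk.localNorm_eq (JohnWalk.posDef_johnMatrix hK hKc hx) (y - x)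
  have hclose : ∀ t : ℝ, t ≤ 1 / 4 → JohnWalk.localNorm K x (y - x) ≤ r * t / Real.sqrt n →
      JohnWalk.tvDist (JohnWalk.transition K r x) (JohnWalk.transition K r y) ≤ 3 / 4 := by
    intro t ht h
    refine JohnWalk.tvDist_transition_le hn hK hKc hx hr0 hrn ?_
    rw [← hnorm]
    rw [le_div_iff₀ hs0] at h
    nlinarith
  refine ⟨fun t ht h => ?_, fun h => (hclose _ (by norm_num) h).trans (by norm_num)⟩
  have ht0 : 0 ≤ t := by
    have h1 : 0 ≤ r * t / Real.sqrt n := (Real.sqrt_nonneg _).trans h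
    rw [le_div_iff₀ hs0, zero_mul] at h1
    exact nonneg_of_mul_nonneg_right h1 hr0
  rcases le_total t (1 / 4) with ht4 | ht4
  · exact (hclose t ht4 h).trans (by linarith)
  · have hy : y ∈ interior K := by
      refine JohnWalk.mem_interior_of_norm_lt hK hKc hx ?_
      rw [← hnorm]
      refine h.trans_lt ?_
      rw [div_lt_iff₀ hs0]
      nlinarith
    have := JohnWalk.isProbabilityMeasure_transition_of_mem_interior hK hKc hr0 hx
    have := JohnWalk.isProbabilityMeasure_transition_of_mem_interior hK hKc hr0 hy
    exact (JohnWalk.tvDist_le_one _ _).trans (by linarith)
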